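/- **Problem.** An instance $I$ consists of a finite set $J$ of jobs, a finite set $M$ of machines, for each job $j$ a set $\mathrm{cap}(j)\subseteq M$, and integers $r_{j,k}\ge 0$ (release dates), $s_{i,j,k}\ge 0$ (setup time for $j$ directly after $i$ on $k$), $d_{j,k}>0$ (durations). A *schedule* $S$ is an assignment $a$ of each job $j$ to a machine $a(j)\in \mathrm{cap}(j)$ together with, for each machine $k$, a total order on the jobs assigned to $k$. If $j_1,\dots,j_l$ is the resulting sequence on $k$, the processing times are $p_{j_1}=d_{j_1,k}$ and $p_{j_i}=s_{j_{i-1},j_i,k}+d_{j_i,k}$ for $i>1$, the start times are $st_{j_1}=r_{j_1,k}$ and $st_{j_i}=\max(r_{j_i,k},\,st_{j_{i-1}}+p_{j_{i-1}})$ for $i>1$, the completion time of $j_i$ is $st_{j_i}+p_{j_i}$, and the span of $k$ is the completion time of $j_l$ (and $0$ if no job is assigned to $k$). The makespan is the largest machine span. The *lex-makespan* of $S$ is the tuple of all machine spans in non-ascending order; lex-makespans are compared lexicographically. **Program.** Let $h\ge 0$ be an integer such that in every schedule of $I$ with minimal lex-makespan all machine spans are at most $h$. Let $P_I$ be the `clingo-dl`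 program consisting of the facts `machine(k)`, `job(j)`, `cap(k,j)` for $k\in\mathrm{cap}(j)$, `duration(j,k,d)` with $d=d_{j,k}$, `release(j,k,r)` with $r=r_{j,k}$, `setup(i,j,k,s)` with $s=s_{i,j,k}$ and $i\neq j$, the facts `int(0)`, …, `int(h)`, and the rules 1 {asg(J,M): cap(M,J)} 1 :- job(J). before(J1,J2,M) | before(J2,J1,M) :- asg(J1,M), asg(J2,M), J1 < J2. 1 {first(J,M): asg(J,M)} 1 :- asg(_,M). 1 {last(J,M): asg(J,M)} 1 :- asg(_,M). 1 {next(J1,J2,M): before(J1,J2,M)} 1 :- asg(J2,M), not first(J2,M). 1 {next(J2,J1,M): before(J2,J1,M)} 1 :- asg(J2,M), not last(J2,M). :- first(J1,M), before(J2,J1,M). :- last(J1,M), before(J1,J2,M). &diff{0 - c(J1)} <= -(T+D+S) :- asg(J1,M), next(J3,J1,M), setup(J3,J1,M,S), duration(J1,M,D), release(J1,M,T). &diff{c(J2) - c(J1)} <= -(P+S) :- before(J2,J1,M), next(J3,J1,M), setup(J3,J1,M,S), duration(J1,M,P). &diff{0 - c(J1)} <= -(T+D) :- asg(J1,M), duration(J1,M,D),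 release(J1,M,T). &diff{c(J) - cmax} <= 0 :- job(J). &diff{c(J2) - c(J1)} <= -P :- before(J2,J1,M), duration(J1,M,P). 1 {span(M,T): int(T)} 1 :- machine(M). &diff{c(J) - 0} <= S :- asg(J,M), span(M,S). #minimize{T@T,M: span(M,T)}. where `<` is a linear order of the constants. An answer set of $P_I$ is an answer set of its grounding (difference atoms being treated as atoms) whose difference constraints `&diff{u - v} <= d`, read as $u-v\le d$ with the variable `0` having value $0$, have a common integer solution. An answer set is optimal if no answer set has a smaller cost, where the cost of $X$ at priority level $t$ is $t$ times the number of machines $k$ with `span(k,t)` in $X$, and costs are compared lexicographically from the highest level downwards. **Claim.** There is a one-to-one correspondence between the schedules of $I$ with minimal lex-makespan and the optimal answer sets of $P_I$. Under it, the answer set $X$ corresponding to $S$ encodes $S$: the atoms in $X$ over `asg`, `before`, `first`, `last`, `next`, `span` are exactly the following: `asg(j,k)` for each job $j$ assigned to $k$; `before(i,j,k)` and `next(i,j,k)` for jobs $i,j$ such that $i$ is processed before, respectively immediately before, $j$ on $k$; `first(j,k)` and `last(j,k)` for the first, respectively last, job $j$ on $k$; and `span(k,t)` where $t$ is the span of $k$.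 Moreover, the difference constraints in $X$ have a least solution on the variables that occur in them, in which `c(j)` is the completion time of $j$ in $S$ for every job $j$, and `cmax` (if there is a job) is the makespan of $S$. -/

import Mathlib

/-! ## Ground answer-set programs

A non-ground rule is represented by the set of all its ground instances.  Ground rules are
disjunctive rules with default negation (a constraint is the case of an empty head, a fact the case
of an empty body) and choice rules with cardinality bounds and conditional elements. -/

namespace ASP

/-- Ground rules over a type `A` of ground atoms.

* `disj head pos neg` is `p₁ | … | pₖ :- q₁, …, qₘ, not r₁, …, not rₙ` with
  `head = {p₁, …, pₖ}`, `pos = {q₁, …, qₘ}` and `neg = {r₁, …, rₙ}`;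
* `choice lo hi elems pos neg` is `lo {a₁ : c₁ ; a₂ : c₂ ; …} hi :- pos, not neg`, where `elems` is
  the set of the pairs of an atom `aᵢ` and its condition `cᵢ` (a conjunction of atoms, given as a
  set). -/
inductive Rule (A : Type*) where
  | disj (head pos neg : Set A)
  | choice (lo hi : ℕ) (elems : Set (A × Set A)) (pos neg : Set A)

/-- A negation-free disjunctive rule `head :- body`. -/
structure PosRule (A : Type*) where
  head : Set A
  body : Set A

variable {A : Type*}

/-- The fact `a.` -/
def fact (a : A) : Rule A := .disj {a} ∅ ∅

/-- The set of atoms of a choice that are chosen in `X`: those with true condition that are true. -/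
def chosen (elems : Set (A × Set A)) (X : Set A) : Set A :=
  {a | a ∈ X ∧ ∃ c, (a, c) ∈ elems ∧ c ⊆ X}

/-- The reduct of a single rule by an interpretation `X`.

A disjunctive rule whose negative body meets `X` is dropped, otherwise its negative body is dropped.
A choice rule stands, as usual, for rules `a | a' :- c, body` with a hidden atom `a'`, one for each
element `a : c`, together with the constraint that rejects interpretations that satisfy the body and
violate the cardinality bounds.  After eliminating the hidden atoms, the reduct of the former
consists of the rules `a :- c, pos` for the elements with `a ∈ X`, and the reduct of the latter of
the constraint `:- pos` if the bounds are violated in `X`. -/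
def Rule.reduct (X : Set A) : Rule A → Set (PosRule A)
  | .disj head pos neg => {r | Disjoint neg X ∧ r = ⟨head, pos⟩}
  | .choice lo hi elems pos neg =>
      {r | Disjoint neg X ∧ ∃ a c, (a, c) ∈ elems ∧ a ∈ X ∧ r = ⟨{a}, c ∪ pos⟩} ∪
      {r | Disjoint neg X ∧
        ¬ ((lo : ℕ∞) ≤ (chosen elems X).encard ∧ (chosen elems X).encard ≤ (hi : ℕ∞)) ∧
        r = ⟨∅, pos⟩}

/-- The reduct `P^X` of a ground program. -/
def reduct (P : Set (Rule A)) (X : Set A) : Set (PosRule A) := ⋃ r ∈ P, r.reduct X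

/-- `Y` is a model of a set of negation-free rules. -/
def IsModel (R : Set (PosRule A)) (Y : Set A) : Prop :=
  ∀ r ∈ R, r.body ⊆ Y → (r.head ∩ Y).Nonempty

/-- `X` is an answer set of `P`: a `⊆`-minimal model of the reduct of `P` by `X`. -/
def IsAnswerSet (P : Set (Rule A)) (X : Set A) : Prop :=
  Minimal (IsModel (reduct P X)) X

/-- A ground element `weight@level,tuple : cond` of a `#minimize` statement. -/
structure MinElem (A T : Type*) where
  weight : ℤ
  level : ℤ
  tuple : T
  cond : Set A

/-- The cost of `X` at priority level `p`: the sum of the weights of the distinct tuples of that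
level whose condition holds in `X`. -/
noncomputable def cost {T : Type*} (E : Set (MinElem A T)) (X : Set A) (p : ℤ) : ℤ :=
  ∑ᶠ wt ∈ {wt : ℤ × T | ∃ e ∈ E, e.level = p ∧ e.weight = wt.1 ∧ e.tuple = wt.2 ∧ e.cond ⊆ X},
    wt.1

/-- `X` has smaller cost than `Y`: the costs are compared lexicographically, a higher priority level
being more important. -/
def Better {T : Type*} (E : Set (MinElem A T)) (X Y : Set A) : Prop :=
  ∃ p : ℤ, cost E X p < cost E Y p ∧ ∀ q : ℤ, p < q → cost E X q = cost E Y q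

end ASP

/-! ## The scheduling problem -/

namespace Sched

open ASP

/-- A problem instance with jobs `J` and machines `M`. -/
structure ProblemInstance (J M : Type*) where
  /-- the machines that can process a job -/
  cap : J → Set M
  /-- `release j k` is the release date of job `j` on machine `k` -/
  release : J → M → ℕ
  /-- `setup i j k` is the time to set up job `j` directly after job `i` on machine `k` -/
  setup : J → J → M → ℕ
  /-- `dur j k` is the duration of job `j` on machine `k` -/
  dur : J → M → ℕ
  dur_pos : ∀ j k, 0 < dur j k

variable {J M : Type*}

/-- A schedule: an assignment of the jobs to capable machines and, for each machine `k`, a total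
order `le k` on the set of the jobs assigned to `k`. -/
@[ext]
structure Schedule (I : ProblemInstance J M) where
  assign : J → M
  assign_cap : ∀ j, assign j ∈ I.cap j
  le : M → J → J → Prop
  le_assigned : ∀ k i j, le k i j → assign i = k ∧ assign j = k
  le_refl : ∀ k j, assign j = k → le k j j
  le_antisymm : ∀ k i j, le k i j → le k j i → i = j
  le_trans : ∀ k i j l, le k i j → le k j l → le k i l
  le_total : ∀ k i j, assign i = k → assign j = k → le k i j ∨ le k j i

namespace Schedule

variable {I : ProblemInstance J M}

/-- Job `i` is processed before job `j` on machine `k`. -/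
def lt (S : Schedule I) (k : M) (i j : J) : Prop := S.le k i j ∧ i ≠ j

/-- Job `j` is the first job on machine `k`. -/
def IsFirst (S : Schedule I) (j : J) (k : M) : Prop :=
  S.assign j = k ∧ ∀ i, S.assign i = k → S.le k j i

/-- Job `j` is the last job on machine `k`. -/
def IsLast (S : Schedule I) (j : J) (k : M) : Prop :=
  S.assign j = k ∧ ∀ i, S.assign i = k → S.le k i j

/-- Job `j` is processed immediately after job `i` on machine `k`. -/
def IsNext (S : Schedule I) (i j : J) (k : M) : Prop :=
  S.lt k i j ∧ ¬ ∃ l, S.lt k i l ∧ S.lt k l j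

open Classical in
/-- The immediate predecessor of a job on its machine, if there is one. -/
noncomputable def pred (S : Schedule I) (j : J) : Option J :=
  if h : ∃ i, S.IsNext i j (S.assign j) then some h.choose else none

theorem isNext_of_pred (S : Schedule I) {i j : J} (h : S.pred j = some i) :
    S.IsNext i j (S.assign j) := by
  unfold pred at h
  split at h
  · next hex =>
    have := hex.choose_spec
    rw [Option.some.inj h] at this
    exact this
  · cases h

/-- The processing time of a job: its duration plus the setup time for its predecessor, if any. -/
noncomputable def procTime (S : Schedule I) (j : J) : ℕ :=
  match S.pred j with
  | none => I.dur j (S.assign j)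
  | some i => I.setup i j (S.assign j) + I.dur j (S.assign j)

open Classical in
/-- The number of jobs that are processed before `j` on its machine. -/
noncomputable def rank [Fintype J] (S : Schedule I) (j : J) : ℕ :=
  (Finset.univ.filter fun i => S.lt (S.assign j) i j).card

theorem rank_lt_of_pred [Fintype J] (S : Schedule I) {i j : J} (h : S.pred j = some i) :
    S.rank i < S.rank j := by
  classical
  have hij := (S.isNext_of_pred h).1
  have hi : S.assign i = S.assign j := (S.le_assigned _ _ _ hij.1).1
  unfold rank
  rw [hi]
  apply Finset.card_lt_card
  rw [Finset.ssubset_iff_of_subset]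
  · exact ⟨i, by simp only [Finset.mem_filter, Finset.mem_univ, true_and]; exact hij,
      fun h' => (Finset.mem_filter.1 h').2.2 rfl⟩
  · intro l hl
    simp only [Finset.mem_filter, Finset.mem_univ, true_and] at hl ⊢
    refine ⟨S.le_trans _ _ _ _ hl.1 hij.1, ?_⟩
    rintro rfl
    exact hl.2 (S.le_antisymm _ _ _ hl.1 hij.1)

/-- The start time of a job: its release date if it is the first one on its machine, and otherwise
the maximum of its release date and the completion time of its predecessor. -/
noncomputable def startTime [Fintype J] (S : Schedule I) (j : J) : ℕ :=
  match _h : S.pred j with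
  | none => I.release j (S.assign j)
  | some i => max (I.release j (S.assign j)) (startTime S i + S.procTime i)
termination_by S.rank j
decreasing_by exact S.rank_lt_of_pred _h

/-- The completion time of a job. -/
noncomputable def completion [Fintype J] (S : Schedule I) (j : J) : ℕ :=
  S.startTime j + S.procTime j

open Classical in
/-- The span of a machine: the completion time of the last job on it, and `0` if there is none. -/
noncomputable def span [Fintype J] (S : Schedule I) (k : M) : ℕ :=
  (Finset.univ.filter fun j => S.IsLast j k).sup S.completion

/-- The makespan: the largest machine span. -/
noncomputable def makespan [Fintype J] [Fintype M] (S : Schedule I) : ℕ :=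
  Finset.univ.sup S.span

/-- The lexicographical makespan: the tuple of all machine spans in non-ascending order. -/
noncomputable def lexMakespan [Fintype J] [Fintype M] (S : Schedule I) : List ℕ :=
  ((Finset.univ : Finset M).val.map S.span).sort (· ≥ ·)

/-- `S` has minimal lex-makespan among all schedules of the instance, with respect to the
lexicographical order. -/
def IsOptimal [Fintype J] [Fintype M] (S : Schedule I) : Prop :=
  ∀ S' : Schedule I, ¬ List.Lex (· < ·) S'.lexMakespan S.lexMakespan

end Schedule

/-! ## The encoding -/

/-- The constants: names of jobs, names of machines, and integers. -/
inductive Const (J M : Type*) where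
  | job (j : J)
  | mach (k : M)
  | num (z : ℤ)

/-- The variables of difference logic: `0` (whose value is fixed), `c(J)`, and `cmax`. -/
inductive DVar (J M : Type*) where
  | zero
  | c (j : Const J M)
  | cmax

/-- The ground atoms; `diff u v d` is the theory atom `&diff{u - v} <= d`. -/
inductive Atom (J M : Type*) where
  | job (j : Const J M)
  | machine (k : Const J M)
  | cap (k j : Const J M)
  | duration (j k d : Const J M)
  | release (j k t : Const J M)
  | setup (i j k s : Const J M)
  | int (t : Const J M)
  | asg (j k : Const J M)
  | before (i j k : Const J M)
  | first (j k : Const J M)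
  | last (j k : Const J M)
  | next (i j k : Const J M)
  | span (k t : Const J M)
  | diff (u v : DVar J M) (d : ℤ)

/-- The integer assignment `ν` satisfies all difference constraints in `X`. -/
def Solves (ν : DVar J M → ℤ) (X : Set (Atom J M)) : Prop :=
  ν .zero = 0 ∧ ∀ u v d, Atom.diff u v d ∈ X → ν u - ν v ≤ d

/-- `X` is an answer set of the program `P` with difference constraints: it is an answer set of `P`
in which the difference constraints are jointly satisfiable in the integers. -/
def IsDLAnswerSet (P : Set (Rule (Atom J M))) (X : Set (Atom J M)) : Prop :=
  IsAnswerSet P X ∧ ∃ ν, Solves ν X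

/-- The variables that occur in the difference constraints in `X`. -/
def dvars (X : Set (Atom J M)) : Set (DVar J M) :=
  {u | ∃ v d, Atom.diff u v d ∈ X ∨ Atom.diff v u d ∈ X}

/-- `ν` is a solution of the difference constraints in `X` in which every occurring variable has the
smallest value possible. -/
def IsLeastSolution (ν : DVar J M → ℤ) (X : Set (Atom J M)) : Prop :=
  Solves ν X ∧ ∀ ν', Solves ν' X → ∀ u ∈ dvars X, ν u ≤ ν' u

/-- `X` is an optimal answer set of the program `P` with the `#minimize` statement `E`. -/
def IsOptimalAnswerSet {T : Type*} (P : Set (Rule (Atom J M))) (E : Set (MinElem (Atom J M) T))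
    (X : Set (Atom J M)) : Prop :=
  IsDLAnswerSet P X ∧ ∀ Y, IsDLAnswerSet P Y → ¬ Better E Y X

section Encoding

open Sched.Const Sched.Atom Sched.DVar

/-- The fact representation of an instance, with the facts `int(0), …, int(h)`. -/
def factAtoms (I : ProblemInstance J M) (h : ℕ) : Set (Atom J M) :=
  {a | ∃ k, a = machine (mach k)} ∪
  {a | ∃ j, a = Atom.job (Const.job j)} ∪
  {a | ∃ j k, k ∈ I.cap j ∧ a = cap (mach k) (.job j)} ∪
  {a | ∃ j k, a = duration (.job j) (mach k) (num (I.dur j k))} ∪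
  {a | ∃ j k, a = release (.job j) (mach k) (num (I.release j k))} ∪
  {a | ∃ i j k, i ≠ j ∧ a = setup (.job i) (.job j) (mach k) (num (I.setup i j k))} ∪
  {a | ∃ t : ℕ, t ≤ h ∧ a = int (num t)}

/-- `1 {asg(J,M): cap(M,J)} 1 :- job(J).` -/
def ruleAsg : Set (Rule (Atom J M)) :=
  {r | ∃ j, r = .choice 1 1 {e | ∃ k, e = (asg j k, {cap k j})} {Atom.job j} ∅}

/-- `before(J1,J2,M) | before(J2,J1,M) :- asg(J1,M), asg(J2,M), J1 < J2.` -/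
def ruleBefore [LinearOrder (Const J M)] : Set (Rule (Atom J M)) :=
  {r | ∃ j₁ j₂ k, j₁ < j₂ ∧
    r = .disj {before j₁ j₂ k, before j₂ j₁ k} {asg j₁ k, asg j₂ k} ∅}

/-- `1 {first(J,M): asg(J,M)} 1 :- asg(_,M).` -/
def ruleFirst : Set (Rule (Atom J M)) :=
  {r | ∃ i k, r = .choice 1 1 {e | ∃ j, e = (first j k, {asg j k})} {asg i k} ∅}

/-- `1 {last(J,M): asg(J,M)} 1 :- asg(_,M).` -/
def ruleLast : Set (Rule (Atom J M)) :=
  {r | ∃ i k, r = .choice 1 1 {e | ∃ j, e = (last j k, {asg j k})} {asg i k} ∅}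

/-- `1 {next(J1,J2,M): before(J1,J2,M)} 1 :- asg(J2,M), not first(J2,M).` -/
def ruleNextIn : Set (Rule (Atom J M)) :=
  {r | ∃ j₂ k, r = .choice 1 1 {e | ∃ j₁, e = (next j₁ j₂ k, {before j₁ j₂ k})}
    {asg j₂ k} {first j₂ k}}

/-- `1 {next(J2,J1,M): before(J2,J1,M)} 1 :- asg(J2,M), not last(J2,M).` -/
def ruleNextOut : Set (Rule (Atom J M)) :=
  {r | ∃ j₂ k, r = .choice 1 1 {e | ∃ j₁, e = (next j₂ j₁ k, {before j₂ j₁ k})}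
    {asg j₂ k} {last j₂ k}}

/-- `:- first(J1,M), before(J2,J1,M).` -/
def ruleFirstOk : Set (Rule (Atom J M)) :=
  {r | ∃ j₁ j₂ k, r = .disj ∅ {first j₁ k, before j₂ j₁ k} ∅}

/-- `:- last(J1,M), before(J1,J2,M).` -/
def ruleLastOk : Set (Rule (Atom J M)) :=
  {r | ∃ j₁ j₂ k, r = .disj ∅ {last j₁ k, before j₁ j₂ k} ∅}

/-- `&diff{0 - c(J1)} <= -(T+D+S) :- asg(J1,M), next(J3,J1,M), setup(J3,J1,M,S),
duration(J1,M,D), release(J1,M,T).`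

Here and below, a variable that occurs in an arithmetic expression ranges over the integers. -/
def ruleRelSetup : Set (Rule (Atom J M)) :=
  {r | ∃ j₁ j₃ k, ∃ t d s : ℤ, r = .disj {diff zero (c j₁) (-(t + d + s))}
    {asg j₁ k, next j₃ j₁ k, setup j₃ j₁ k (num s), duration j₁ k (num d),
      release j₁ k (num t)} ∅}

/-- `&diff{c(J2) - c(J1)} <= -(P+S) :- before(J2,J1,M), next(J3,J1,M), setup(J3,J1,M,S),
duration(J1,M,P).` -/
def ruleSeqSetup : Set (Rule (Atom J M)) :=
  {r | ∃ j₁ j₂ j₃ k, ∃ p s : ℤ, r = .disj {diff (c j₂) (c j₁) (-(p + s))}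
    {before j₂ j₁ k, next j₃ j₁ k, setup j₃ j₁ k (num s), duration j₁ k (num p)} ∅}

/-- `&diff{0 - c(J1)} <= -(T+D) :- asg(J1,M), duration(J1,M,D), release(J1,M,T).` -/
def ruleRel : Set (Rule (Atom J M)) :=
  {r | ∃ j₁ k, ∃ t d : ℤ, r = .disj {diff zero (c j₁) (-(t + d))}
    {asg j₁ k, duration j₁ k (num d), release j₁ k (num t)} ∅}

/-- `&diff{c(J) - cmax} <= 0 :- job(J).` -/
def ruleMax : Set (Rule (Atom J M)) :=
  {r | ∃ j, r = .disj {diff (c j) cmax 0} {Atom.job j} ∅}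

/-- `&diff{c(J2) - c(J1)} <= -P :- before(J2,J1,M), duration(J1,M,P).` -/
def ruleSeq : Set (Rule (Atom J M)) :=
  {r | ∃ j₁ j₂ k, ∃ p : ℤ, r = .disj {diff (c j₂) (c j₁) (-p)}
    {before j₂ j₁ k, duration j₁ k (num p)} ∅}

/-- `1 {span(M,T): int(T)} 1 :- machine(M).` -/
def ruleSpan : Set (Rule (Atom J M)) :=
  {r | ∃ k, r = .choice 1 1 {e | ∃ t, e = (span k t, {int t})} {machine k} ∅}

/-- `&diff{c(J) - 0} <= S :- asg(J,M), span(M,S).` -/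
def ruleSpanOk : Set (Rule (Atom J M)) :=
  {r | ∃ j k, ∃ s : ℤ, r = .disj {diff (c j) zero s} {asg j k, span k (num s)} ∅}

/-- The (ground) program for the instance `I`: its facts and the rules above.  The built-in
comparison `J1 < J2` of the language is interpreted by a linear order of the constants. -/
def program [LinearOrder (Const J M)] (I : ProblemInstance J M) (h : ℕ) :
    Set (Rule (Atom J M)) :=
  {r | ∃ a ∈ factAtoms I h, r = fact a} ∪ ruleAsg ∪ ruleBefore ∪ ruleFirst ∪ ruleLast ∪ ruleNextIn ∪
    ruleNextOut ∪ ruleFirstOk ∪ ruleLastOk ∪ ruleRelSetup ∪ ruleSeqSetup ∪ ruleRel ∪ ruleMax ∪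
    ruleSeq ∪ ruleSpan ∪ ruleSpanOk

/-- `#minimize{T@T,M: span(M,T)}.` -/
def objective : Set (MinElem (Atom J M) (Const J M)) :=
  {e | ∃ (t : ℤ) (k : Const J M), e = ⟨t, t, k, {span k (num t)}⟩}

/-- The answer set `X` encodes the schedule `S`: the atoms over `asg`, `before`, `next`, `first`,
`last`, `span` in `X` are those that describe `S`, and the integer variables `c(j)` and `cmax` (which
occurs if there is a job), when set to the smallest values possible, are the completion times of the
jobs and the makespan. -/
structure Encodes [Fintype J] [Fintype M] {I : ProblemInstance J M} (S : Schedule I)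
    (X : Set (Atom J M)) : Prop where
  asg_iff : ∀ x z, asg x z ∈ X ↔ ∃ j k, x = .job j ∧ z = mach k ∧ S.assign j = k
  before_iff : ∀ x y z, before x y z ∈ X ↔
    ∃ i j k, x = .job i ∧ y = .job j ∧ z = mach k ∧ S.lt k i j
  next_iff : ∀ x y z, next x y z ∈ X ↔
    ∃ i j k, x = .job i ∧ y = .job j ∧ z = mach k ∧ S.IsNext i j k
  first_iff : ∀ x z, first x z ∈ X ↔ ∃ j k, x = .job j ∧ z = mach k ∧ S.IsFirst j k
  last_iff : ∀ x z, last x z ∈ X ↔ ∃ j k, x = .job j ∧ z = mach k ∧ S.IsLast j k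
  span_iff : ∀ z t, span z t ∈ X ↔ ∃ k, z = mach k ∧ t = num (S.span k)
  values : ∃ ν, IsLeastSolution ν X ∧ (∀ j, ν (c (.job j)) = S.completion j) ∧
    (Nonempty J → ν cmax = S.makespan)

end Encoding

end Sched

/-!
The answer sets of the program with satisfiable difference constraints are exactly the sets
`answer h S t`, where `S` is a schedule and `t` assigns to every machine `k` a bound `t k` with
`S.span k ≤ t k ≤ h` (`isDLAnswerSet_iff`).

That each `answer h S t` is an answer set (`isAnswerSet_answer`) holds since the program is
stratified apart from its choices: facts, `asg`, `before`, the remaining choices and the difference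
constraints are derived in this order, so that a model of the reduct cannot lack any of the atoms.
The completion times and the makespan of `S` solve the constraints, and an induction along the
sequence of each machine shows that they are below every other solution
(`isLeastSolution_values`). As the constraints include `c(j) ≤ t k`, they are solvable only if `t`
bounds the spans.

Conversely, every atom of an answer set is supported by a rule (`IsAnswerSet.exists_supports`).
This makes `before` a tournament on the jobs of each machine. Durations are positive, so the values
`c(j)` of a solution increase along `before`, which is therefore a linear order and yields a
schedule; the cardinality bounds then leave only the intended atoms over `first`, `last` and `next`
(`exists_eq_answer`).

Finally, the cost of `answer h S t` at a level `p ≥ 0` is `p` times the multiplicity of `p` in the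
tuple `t`, and comparing non-ascending tuples lexicographically amounts to comparing multiplicities
from the largest number downwards (`CountLT`, `lex_sort_iff`, `better_objective_iff`). Lowering a
bound `t k` to the span of `k` improves the cost, so optimal answer sets have tight bounds, and the
order of their costs is that of the lex-makespans (`isOptimalAnswerSet_iff`). The hypothesis on `h`
enters through the existence of an optimal schedule below any schedule that is not optimal: its
answer set is available.
-/

/-! ### Reducts, satisfaction and support -/

namespace ASP

variable {A : Type*}

/-- `X` satisfies a ground rule classically, the bounds of a choice rule included. -/
def Rule.Sat (X : Set A) : Rule A → Prop
  | .disj head pos neg => pos ⊆ X → Disjoint neg X → (head ∩ X).Nonempty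
  | .choice lo hi elems pos neg => pos ⊆ X → Disjoint neg X →
      (lo : ℕ∞) ≤ (chosen elems X).encard ∧ (chosen elems X).encard ≤ (hi : ℕ∞)

theorem sat_disj_iff {X head pos neg : Set A} :
    (Rule.disj head pos neg).Sat X ↔ (pos ⊆ X → Disjoint neg X → (head ∩ X).Nonempty) :=
  Iff.rfl

theorem isModel_reduct_self_iff {P : Set (Rule A)} {X : Set A} :
    IsModel (reduct P X) X ↔ ∀ r ∈ P, r.Sat X := by
  constructor
  · rintro hX (⟨head, pos, neg⟩ | ⟨lo, hi, elems, pos, neg⟩) hr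
    · intro hp hn
      exact hX ⟨head, pos⟩ (Set.mem_biUnion hr ⟨hn, rfl⟩) hp
    · intro hp hn
      by_contra hc
      have := hX ⟨∅, pos⟩ (Set.mem_biUnion hr (Or.inr ⟨hn, hc, rfl⟩)) hp
      simp at this
  · intro hX r hr hb
    obtain ⟨R, hR, hr⟩ := Set.mem_iUnion₂.1 hr
    have hs := hX R hR
    rcases R with ⟨head, pos, neg⟩ | ⟨lo, hi, elems, pos, neg⟩
    · obtain ⟨hn, rfl⟩ := hr
      exact hs hb hn
    · rcases hr with ⟨-, a, c, -, ha, rfl⟩ | ⟨hn, hc, rfl⟩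
      · exact ⟨a, rfl, ha⟩
      · exact absurd (hs hb hn) hc

/-- `r` gives a reason for the atom `a` in `X`: the body of `r` holds, and `a` is the only true
atom of its head, respectively a chosen element. -/
def Rule.Supports (X : Set A) (a : A) : Rule A → Prop
  | .disj head pos neg => head ∩ X = {a} ∧ pos ⊆ X ∧ Disjoint neg X
  | .choice _ _ elems pos neg => ∃ c, (a, c) ∈ elems ∧ c ⊆ X ∧ pos ⊆ X ∧ Disjoint neg X

/-- In an answer set every atom is supported: an atom without support could be removed. -/
theorem IsAnswerSet.exists_supports {P : Set (Rule A)} {X : Set A} (hX : IsAnswerSet P X) {a : A}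
    (ha : a ∈ X) : ∃ r ∈ P, r.Supports X a := by
  by_contra! hno
  refine (hX.le_of_le (y := X \ {a}) ?_ Set.sdiff_subset ha).2 rfl
  intro r hr hb
  have hbX := hb.trans Set.sdiff_subset
  obtain ⟨b, hbh, hb'⟩ := hX.prop r hr hbX
  by_contra hne
  have hall : ∀ b ∈ r.head, b ∈ X → b = a := by
    intro b h1 h2
    by_contra h3
    exact hne ⟨b, h1, h2, h3⟩
  obtain rfl := hall b hbh hb'
  obtain ⟨R, hR, hr⟩ := Set.mem_iUnion₂.1 hr
  refine hno R hR ?_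
  rcases R with ⟨head, pos, neg⟩ | ⟨lo, hi, elems, pos, neg⟩
  · obtain ⟨hn, rfl⟩ := hr
    refine ⟨?_, hbX, hn⟩
    ext x
    simp only [Set.mem_inter_iff, Set.mem_singleton_iff]
    exact ⟨fun hx => hall x hx.1 hx.2, fun hx => hx ▸ ⟨hbh, hb'⟩⟩
  · rcases hr with ⟨hn, a, c, hac, -, rfl⟩ | ⟨-, -, rfl⟩
    · obtain rfl : b = a := hbh
      exact ⟨c, hac, Set.subset_union_left.trans hbX, Set.subset_union_right.trans hbX, hn⟩
    · exact hbh.elim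

theorem IsModel.disj_mem {P : Set (Rule A)} {X Y : Set A} (hY : IsModel (reduct P X) Y)
    {head pos neg : Set A} (hr : Rule.disj head pos neg ∈ P) (hn : Disjoint neg X) (hp : pos ⊆ Y) :
    (head ∩ Y).Nonempty :=
  hY ⟨head, pos⟩ (Set.mem_biUnion hr ⟨hn, rfl⟩) hp

theorem IsModel.choice_mem {P : Set (Rule A)} {X Y : Set A} (hY : IsModel (reduct P X) Y)
    {lo hi : ℕ} {elems : Set (A × Set A)} {pos neg c : Set A} {a : A}
    (hr : Rule.choice lo hi elems pos neg ∈ P) (hn : Disjoint neg X) (hac : (a, c) ∈ elems)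
    (ha : a ∈ X) (hc : c ⊆ Y) (hp : pos ⊆ Y) : a ∈ Y := by
  obtain ⟨b, rfl, hb⟩ := hY ⟨{a}, c ∪ pos⟩
    (Set.mem_biUnion hr (Or.inl ⟨hn, a, c, hac, ha, rfl⟩)) (Set.union_subset hc hp)
  exact hb

/-- A choice rule `1 {f(K) : g(K)} 1` demands that exactly one instance is chosen. -/
theorem sat_choice_one_iff {ι : Type*} {X pos neg : Set A} {f g : ι → A}
    (hf : Function.Injective f) :
    (Rule.choice 1 1 {e | ∃ k, e = (f k, {g k})} pos neg).Sat X ↔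
      (pos ⊆ X → Disjoint neg X → ∃! k, g k ∈ X ∧ f k ∈ X) := by
  have hch : chosen {e | ∃ k, e = (f k, {g k})} X = f '' {k | g k ∈ X ∧ f k ∈ X} := by
    ext a
    constructor
    · rintro ⟨ha, c, ⟨k, hk⟩, hc⟩
      obtain ⟨rfl, rfl⟩ := Prod.mk.inj hk
      exact ⟨k, ⟨hc rfl, ha⟩, rfl⟩
    · rintro ⟨k, ⟨h1, h2⟩, rfl⟩
      exact ⟨h2, _, ⟨k, rfl⟩, Set.singleton_subset_iff.2 h1⟩
  have hone : ((1 : ℕ) : ℕ∞) ≤ (chosen {e | ∃ k, e = (f k, {g k})} X).encard ∧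
      (chosen {e | ∃ k, e = (f k, {g k})} X).encard ≤ ((1 : ℕ) : ℕ∞) ↔
      ∃! k, g k ∈ X ∧ f k ∈ X := by
    rw [hch, hf.encard_image, and_comm, ← le_antisymm_iff, Nat.cast_one, Set.encard_eq_one]
    simp only [Set.eq_singleton_iff_unique_mem]
    rfl
  simp only [Rule.Sat, hone]

end ASP

/-! ### The rules of the scheduling program -/

namespace Sched

open ASP

variable {J M : Type*}

/-- The rules whose heads are difference constraints. -/
def diffRules : Set (Rule (Atom J M)) :=
  ruleRelSetup ∪ ruleSeqSetup ∪ ruleRel ∪ ruleMax ∪ ruleSeq ∪ ruleSpanOk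

/-- The atom is a difference constraint. -/
def Atom.IsDiff : Atom J M → Prop
  | .diff _ _ _ => True
  | _ => False

/-- The difference constraints that are derived from the atoms in `B`. -/
def diffAtoms (B : Set (Atom J M)) : Set (Atom J M) :=
  {a | ∃ pos, Rule.disj {a} pos ∅ ∈ diffRules ∧ pos ⊆ B}

/-- Difference constraints occur only as the heads of rules: the derivation of the constraints is
the last stratum of the program. -/
theorem diffRules_shape {r : Rule (Atom J M)} (hr : r ∈ diffRules) :
    ∃ a pos, r = .disj {a} pos ∅ ∧ a.IsDiff ∧ ∀ b ∈ pos, ¬ b.IsDiff := by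
  rcases hr with ((((⟨j₁, j₃, k, t, d, s, rfl⟩ | ⟨j₁, j₂, j₃, k, p, s, rfl⟩) | ⟨j₁, k, t, d, rfl⟩) |
    ⟨j, rfl⟩) | ⟨j₁, j₂, k, p, rfl⟩) | ⟨j, k, s, rfl⟩ <;>
  exact ⟨_, _, rfl, trivial, by simp [Atom.IsDiff]⟩

theorem isDiff_of_mem_diffAtoms {B : Set (Atom J M)} {a : Atom J M} (ha : a ∈ diffAtoms B) :
    a.IsDiff := by
  obtain ⟨pos, hr, -⟩ := ha
  obtain ⟨b, pos', h, hb, -⟩ := diffRules_shape hr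
  rw [Rule.disj.injEq, Set.singleton_eq_singleton_iff] at h
  exact h.1 ▸ hb

/-- The derived constraints depend only on the atoms that are not themselves constraints. -/
theorem diffAtoms_congr {B C : Set (Atom J M)} (h : ∀ a, ¬ a.IsDiff → a ∈ B → a ∈ C) :
    diffAtoms B ⊆ diffAtoms C := by
  rintro a ⟨pos, hr, hp⟩
  refine ⟨pos, hr, fun b hb => h b ?_ (hp hb)⟩
  obtain ⟨a', pos', h', -, hpos⟩ := diffRules_shape hr
  rw [Rule.disj.injEq] at h'
  exact hpos b (h'.2.1 ▸ hb)

section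

variable [LinearOrder (Const J M)] {I : ProblemInstance J M} {h : ℕ} {X : Set (Atom J M)}

theorem diffRules_subset_program : diffRules ⊆ program I h := by
  unfold diffRules program
  intro r hr
  simp only [Set.mem_union] at hr ⊢
  tauto

/-- What it means for a set of atoms to satisfy the rules of the program. -/
structure ProgramSat (I : ProblemInstance J M) (h : ℕ) (X : Set (Atom J M)) : Prop where
  facts : factAtoms I h ⊆ X
  asg : ∀ x, .job x ∈ X → ∃! z, .cap z x ∈ X ∧ .asg x z ∈ X
  before : ∀ x y z, x < y → .asg x z ∈ X → .asg y z ∈ X → .before x y z ∈ X ∨ .before y x z ∈ X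
  first : ∀ y z, .asg y z ∈ X → ∃! x, .asg x z ∈ X ∧ .first x z ∈ X
  last : ∀ y z, .asg y z ∈ X → ∃! x, .asg x z ∈ X ∧ .last x z ∈ X
  next_in : ∀ y z, .asg y z ∈ X → .first y z ∉ X → ∃! x, .before x y z ∈ X ∧ .next x y z ∈ X
  next_out : ∀ x z, .asg x z ∈ X → .last x z ∉ X → ∃! y, .before x y z ∈ X ∧ .next x y z ∈ X
  first_ok : ∀ x y z, .first x z ∈ X → .before y x z ∉ X
  last_ok : ∀ x y z, .last x z ∈ X → .before x y z ∉ X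
  span : ∀ z, .machine z ∈ X → ∃! t, .int t ∈ X ∧ .span z t ∈ X
  diffs : diffAtoms X ⊆ X

theorem forall_mem_range₂ {α β γ : Type*} {f : α → β → γ} {p : γ → Prop} :
    (∀ r ∈ {r | ∃ a b, r = f a b}, p r) ↔ ∀ a b, p (f a b) :=
  ⟨fun H a b => H _ ⟨a, b, rfl⟩, by rintro H _ ⟨a, b, rfl⟩; exact H a b⟩

theorem forall_mem_range₃ {α β γ δ : Type*} {f : α → β → γ → δ} {p : δ → Prop} :
    (∀ r ∈ {r | ∃ a b c, r = f a b c}, p r) ↔ ∀ a b c, p (f a b c) :=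
  ⟨fun H a b c => H _ ⟨a, b, c, rfl⟩, by rintro H _ ⟨a, b, c, rfl⟩; exact H a b c⟩

theorem sat_program_iff : (∀ r ∈ program I h, r.Sat X) ↔ ProgramSat I h X := by
  have hfact : (∀ r ∈ {r | ∃ a ∈ factAtoms I h, r = fact a}, r.Sat X) ↔ factAtoms I h ⊆ X := by
    have : ∀ a, (fact a).Sat X ↔ a ∈ X := by simp [fact, sat_disj_iff]
    exact ⟨fun H a ha => (this a).1 (H _ ⟨a, ha, rfl⟩),
      by rintro H _ ⟨a, ha, rfl⟩; exact (this a).2 (H ha)⟩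
  have hasg : (∀ r ∈ ruleAsg, r.Sat X) ↔
      ∀ x, .job x ∈ X → ∃! z, .cap z x ∈ X ∧ .asg x z ∈ X := by
    have := fun x : Const J M => sat_choice_one_iff (X := X) (pos := {.job x}) (neg := ∅)
      (g := fun z => .cap z x)
      (f := Atom.asg x) (fun a b hab => by simpa using hab)
    simp [ruleAsg, this]
  have hbefore : (∀ r ∈ ruleBefore, r.Sat X) ↔ ∀ x y z, x < y → .asg x z ∈ X → .asg y z ∈ X →
      .before x y z ∈ X ∨ .before y x z ∈ X := by
    constructor
    · intro H x y z hxy h1 h2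
      obtain ⟨a, rfl | rfl, ha⟩ := H _ ⟨x, y, z, hxy, rfl⟩ (by simp [Set.insert_subset_iff, *])
        (by simp)
      exacts [.inl ha, .inr ha]
    · rintro H _ ⟨x, y, z, hxy, rfl⟩ hp -
      simp only [Set.insert_subset_iff, Set.singleton_subset_iff] at hp
      rcases H x y z hxy hp.1 hp.2 with h1 | h1
      exacts [⟨_, .inl rfl, h1⟩, ⟨_, .inr rfl, h1⟩]
  have hfirst : (∀ r ∈ ruleFirst, r.Sat X) ↔
      ∀ y z, .asg y z ∈ X → ∃! x, .asg x z ∈ X ∧ .first x z ∈ X := by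
    have := fun y z : Const J M => sat_choice_one_iff (X := X) (pos := {.asg y z}) (neg := ∅)
      (g := fun x => .asg x z) (f := fun x => Atom.first x z) (fun a b hab => by simpa using hab)
    refine (forall_mem_range₂ (p := Rule.Sat X)).trans ?_
    simp [this]
  have hlast : (∀ r ∈ ruleLast, r.Sat X) ↔
      ∀ y z, .asg y z ∈ X → ∃! x, .asg x z ∈ X ∧ .last x z ∈ X := by
    have := fun y z : Const J M => sat_choice_one_iff (X := X) (pos := {.asg y z}) (neg := ∅)
      (g := fun x => .asg x z) (f := fun x => Atom.last x z) (fun a b hab => by simpa using hab)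
    refine (forall_mem_range₂ (p := Rule.Sat X)).trans ?_
    simp [this]
  have hin : (∀ r ∈ ruleNextIn, r.Sat X) ↔ ∀ y z, .asg y z ∈ X → .first y z ∉ X →
      ∃! x, .before x y z ∈ X ∧ .next x y z ∈ X := by
    have := fun y z : Const J M => sat_choice_one_iff (X := X) (pos := {.asg y z})
      (neg := {.first y z})
      (g := fun x => .before x y z) (f := fun x => Atom.next x y z)
      (fun a b hab => by simpa using hab)
    refine (forall_mem_range₂ (p := Rule.Sat X)).trans ?_
    simp [this]
  have hout : (∀ r ∈ ruleNextOut, r.Sat X) ↔ ∀ x z, .asg x z ∈ X → .last x z ∉ X →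
      ∃! y, .before x y z ∈ X ∧ .next x y z ∈ X := by
    have := fun x z : Const J M => sat_choice_one_iff (X := X) (pos := {.asg x z})
      (neg := {.last x z})
      (g := fun y => .before x y z) (f := fun y => Atom.next x y z)
      (fun a b hab => by simpa using hab)
    refine (forall_mem_range₂ (p := Rule.Sat X)).trans ?_
    simp [this]
  have hfirstOk : (∀ r ∈ ruleFirstOk, r.Sat X) ↔
      ∀ x y z, .first x z ∈ X → .before y x z ∉ X := by
    refine (forall_mem_range₃ (p := Rule.Sat X)).trans ?_
    simp [sat_disj_iff, Set.insert_subset_iff]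
  have hlastOk : (∀ r ∈ ruleLastOk, r.Sat X) ↔ ∀ x y z, .last x z ∈ X → .before x y z ∉ X := by
    refine (forall_mem_range₃ (p := Rule.Sat X)).trans ?_
    simp [sat_disj_iff, Set.insert_subset_iff]
  have hspan : (∀ r ∈ ruleSpan, r.Sat X) ↔
      ∀ z, .machine z ∈ X → ∃! t, .int t ∈ X ∧ .span z t ∈ X := by
    have := fun z : Const J M => sat_choice_one_iff (X := X) (pos := {.machine z})
      (neg := ∅) (g := Atom.int)
      (f := Atom.span z) (fun a b hab => by simpa using hab)
    simp [ruleSpan, this]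
  have hdiff : (∀ r ∈ diffRules, r.Sat X) ↔ diffAtoms X ⊆ X := by
    constructor
    · rintro H a ⟨pos, hr, hp⟩
      obtain ⟨b, rfl, hb⟩ := H _ hr hp (by simp)
      exact hb
    · intro H r hr
      obtain ⟨a, pos, rfl, -, -⟩ := diffRules_shape hr
      exact fun hp _ => ⟨a, rfl, H ⟨pos, hr, hp⟩⟩
  have hsplit : (∀ r ∈ program I h, r.Sat X) ↔
      (∀ r ∈ {r | ∃ a ∈ factAtoms I h, r = fact a}, r.Sat X) ∧ (∀ r ∈ ruleAsg, r.Sat X) ∧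
      (∀ r ∈ ruleBefore, r.Sat X) ∧ (∀ r ∈ ruleFirst, r.Sat X) ∧ (∀ r ∈ ruleLast, r.Sat X) ∧
      (∀ r ∈ ruleNextIn, r.Sat X) ∧ (∀ r ∈ ruleNextOut, r.Sat X) ∧ (∀ r ∈ ruleFirstOk, r.Sat X) ∧
      (∀ r ∈ ruleLastOk, r.Sat X) ∧ (∀ r ∈ ruleSpan, r.Sat X) ∧ (∀ r ∈ diffRules, r.Sat X) := by
    simp only [program, diffRules, Set.mem_union, or_imp, forall_and,
      and_assoc]
    exact ⟨fun ⟨a, b, c, d, e, f, g, i, j, k, l, m, n, o, p, q⟩ =>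
        ⟨a, b, c, d, e, f, g, i, j, p, k, l, m, n, o, q⟩,
      fun ⟨a, b, c, d, e, f, g, i, j, p, k, l, m, n, o, q⟩ =>
        ⟨a, b, c, d, e, f, g, i, j, k, l, m, n, o, p, q⟩⟩
  rw [hsplit, hfact, hasg, hbefore, hfirst, hlast, hin, hout, hfirstOk, hlastOk, hspan, hdiff]
  exact ⟨fun ⟨a, b, c, d, e, f, g, i, j, k, l⟩ => ⟨a, b, c, d, e, f, g, i, j, k, l⟩,
    fun ⟨a, b, c, d, e, f, g, i, j, k, l⟩ => ⟨a, b, c, d, e, f, g, i, j, k, l⟩⟩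

/-- The reason that an atom must have to be in an answer set `X` of the program. -/
def Reason (I : ProblemInstance J M) (h : ℕ) (X : Set (Atom J M)) : Atom J M → Prop
  | .asg x z => .job x ∈ X ∧ .cap z x ∈ X
  | .before x y z => .asg x z ∈ X ∧ .asg y z ∈ X ∧ x ≠ y ∧ .before y x z ∉ X
  | .first x z => .asg x z ∈ X
  | .last x z => .asg x z ∈ X
  | .next x y z => .before x y z ∈ X
  | .span z t => .machine z ∈ X ∧ .int t ∈ X
  | .diff u v d => .diff u v d ∈ diffAtoms X
  | a => a ∈ factAtoms I h

theorem reason_of_mem (hX : IsAnswerSet (program I h) X) {a : Atom J M} (ha : a ∈ X) :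
    Reason I h X a := by
  obtain ⟨r, hr, hs⟩ := hX.exists_supports ha
  have hsplit : r ∈ diffRules ∨ r ∈ {r | ∃ a ∈ factAtoms I h, r = fact a} ∨ r ∈ ruleAsg ∨
      r ∈ ruleBefore ∨ r ∈ ruleFirst ∨ r ∈ ruleLast ∨ r ∈ ruleNextIn ∨ r ∈ ruleNextOut ∨
      r ∈ ruleFirstOk ∨ r ∈ ruleLastOk ∨ r ∈ ruleSpan := by
    simp only [program, diffRules, Set.mem_union] at hr ⊢
    tauto
  rcases hsplit with hr | ⟨b, hb, rfl⟩ | ⟨x, rfl⟩ | ⟨x, y, z, hxy, rfl⟩ | ⟨x, z, rfl⟩ | ⟨x, z, rfl⟩ |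
    ⟨x, z, rfl⟩ | ⟨x, z, rfl⟩ | ⟨x, y, z, rfl⟩ | ⟨x, y, z, rfl⟩ | ⟨z, rfl⟩
  · obtain ⟨b, pos, rfl, hb, -⟩ := diffRules_shape hr
    obtain ⟨h1, h2, -⟩ := hs
    have : a = b := (h1.symm ▸ Set.mem_singleton a : a ∈ {b} ∩ X).1
    subst this
    cases a <;> first | exact hb.elim | exact ⟨pos, hr, h2⟩
  · obtain ⟨h1, -, -⟩ := hs
    have : a = b := (h1.symm ▸ Set.mem_singleton a : a ∈ {b} ∩ X).1
    subst this
    rcases hb with (((((⟨_, rfl⟩ | ⟨_, rfl⟩) | ⟨_, _, _, rfl⟩) | ⟨_, _, rfl⟩) | ⟨_, _, rfl⟩) |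
      ⟨_, _, _, _, rfl⟩) | ⟨_, _, rfl⟩ <;> simp [Reason, factAtoms, *]
  · obtain ⟨c, ⟨k, hk⟩, hc, hp, -⟩ := hs
    obtain ⟨rfl, rfl⟩ := Prod.mk.inj hk
    exact ⟨hp rfl, hc rfl⟩
  · obtain ⟨h1, h2, -⟩ := hs
    simp only [Set.insert_subset_iff, Set.singleton_subset_iff] at h2
    have hmem : ∀ b, b ∈ ({.before x y z, .before y x z} : Set (Atom J M)) → b ∈ X → b = a := by
      intro b hb hbX
      have : b ∈ ({a} : Set (Atom J M)) := h1 ▸ ⟨hb, hbX⟩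
      exact this
    have ha' : a ∈ ({.before x y z, .before y x z} : Set (Atom J M)) :=
      (h1.symm ▸ Set.mem_singleton a : a ∈ _ ∩ X).1
    rcases ha' with rfl | rfl
    · refine ⟨h2.1, h2.2, hxy.ne, fun hc => ?_⟩
      have := hmem _ (.inr rfl) hc
      simp only [Atom.before.injEq] at this
      exact hxy.ne this.2.1
    · refine ⟨h2.2, h2.1, hxy.ne', fun hc => ?_⟩
      have := hmem _ (.inl rfl) hc
      simp only [Atom.before.injEq] at this
      exact hxy.ne this.1
  all_goals first
    | (obtain ⟨c, ⟨k, hk⟩, hc, hp, -⟩ := hs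
       obtain ⟨rfl, rfl⟩ := Prod.mk.inj hk
       first | exact hc rfl | exact ⟨hp rfl, hc rfl⟩)
    | (obtain ⟨h1, -, -⟩ := hs
       exact (h1.symm ▸ Set.mem_singleton a : a ∈ ∅ ∩ X).1.elim)

end

end Sched

/-! ### The sequence of jobs on a machine, and completion times -/

namespace Sched

namespace Schedule

variable {J M : Type*} {I : ProblemInstance J M} (S : Schedule I) {i j l : J} {k : M}

theorem lt_trans (h₁ : S.lt k i j) (h₂ : S.lt k j l) : S.lt k i l := by
  refine ⟨S.le_trans _ _ _ _ h₁.1 h₂.1, ?_⟩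
  rintro rfl
  exact h₁.2 (S.le_antisymm _ _ _ h₁.1 h₂.1)

theorem lt_asymm (h₁ : S.lt k i j) : ¬ S.lt k j i := fun h₂ => (S.lt_trans h₁ h₂).2 rfl

theorem lt_trichotomy (hi : S.assign i = k) (hj : S.assign j = k) :
    S.lt k i j ∨ i = j ∨ S.lt k j i := by
  by_cases hij : i = j
  · exact .inr (.inl hij)
  · exact (S.le_total k i j hi hj).imp (⟨·, hij⟩) fun h => .inr ⟨h, Ne.symm hij⟩

theorem lt_assign (h : S.lt k i j) : S.assign i = k ∧ S.assign j = k := S.le_assigned _ _ _ h.1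

theorem isFirst_iff : S.IsFirst j k ↔ S.assign j = k ∧ ∀ i, ¬ S.lt k i j := by
  refine and_congr_right fun hj => ⟨fun h i hi => ?_, fun h i hi => ?_⟩
  · exact hi.2 (S.le_antisymm _ _ _ hi.1 (h i (S.lt_assign hi).1))
  · rcases S.lt_trichotomy hi hj with h' | rfl | h'
    exacts [(h i h').elim, S.le_refl _ _ hj, h'.1]

theorem isLast_iff : S.IsLast j k ↔ S.assign j = k ∧ ∀ i, ¬ S.lt k j i := by
  refine and_congr_right fun hj => ⟨fun h i hi => ?_, fun h i hi => ?_⟩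
  · exact hi.2 (S.le_antisymm _ _ _ hi.1 (h i (S.lt_assign hi).2))
  · rcases S.lt_trichotomy hi hj with h' | rfl | h'
    exacts [h'.1, S.le_refl _ _ hj, (h i h').elim]

theorem IsFirst.unique {S : Schedule I} (hi : S.IsFirst i k) (hj : S.IsFirst j k) : i = j :=
  S.le_antisymm _ _ _ (hi.2 j hj.1) (hj.2 i hi.1)

theorem IsLast.unique {S : Schedule I} (hi : S.IsLast i k) (hj : S.IsLast j k) : i = j :=
  S.le_antisymm _ _ _ (hj.2 i hi.1) (hi.2 j hj.1)

theorem IsNext.unique_left {S : Schedule I} (hi : S.IsNext i l k) (hj : S.IsNext j l k) :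
    i = j := by
  rcases S.lt_trichotomy (S.lt_assign hi.1).1 (S.lt_assign hj.1).1 with h | h | h
  exacts [(hi.2 ⟨j, h, hj.1⟩).elim, h, (hj.2 ⟨i, h, hi.1⟩).elim]

theorem IsNext.unique_right {S : Schedule I} (hi : S.IsNext l i k) (hj : S.IsNext l j k) :
    i = j := by
  rcases S.lt_trichotomy (S.lt_assign hi.1).2 (S.lt_assign hj.1).2 with h | h | h
  exacts [(hj.2 ⟨i, hi.1, h⟩).elim, h, (hi.2 ⟨j, hj.1, h⟩).elim]

theorem pred_eq_some_iff : S.pred j = some i ↔ S.IsNext i j (S.assign j) := by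
  refine ⟨S.isNext_of_pred, fun h => ?_⟩
  have hex : ∃ i, S.IsNext i j (S.assign j) := ⟨i, h⟩
  rw [pred, dif_pos hex, Option.some_inj]
  exact hex.choose_spec.unique_left h

variable [Fintype J]

/-- The rank serves as the measure for inductions along the sequence of a machine. -/
theorem rank_lt (h : S.lt k i j) : S.rank i < S.rank j := by
  classical
  obtain ⟨hi, hj⟩ := S.lt_assign h
  unfold rank
  rw [hi, hj]
  refine Finset.card_lt_card ((Finset.ssubset_iff_of_subset fun l hl => ?_).2 ⟨i, ?_, ?_⟩)
  · simp only [Finset.mem_filter, Finset.mem_univ, true_and] at hl ⊢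
    exact S.lt_trans hl h
  · simpa using h
  · exact fun hmem => (Finset.mem_filter.1 hmem).2.2 rfl

theorem exists_isNext_left (h : S.lt k i j) : ∃ l, S.IsNext l j k := by
  classical
  obtain ⟨l, hl, hmax⟩ := Finset.exists_max_image (Finset.univ.filter fun l => S.lt k l j) S.rank
    ⟨i, by simpa using h⟩
  simp only [Finset.mem_filter, Finset.mem_univ, true_and] at hl hmax
  exact ⟨l, hl, fun ⟨m, h1, h2⟩ => (S.rank_lt h1).not_ge (hmax m h2)⟩

theorem exists_isNext_right (h : S.lt k i j) : ∃ l, S.IsNext i l k := by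
  classical
  obtain ⟨l, hl, hmin⟩ := Finset.exists_min_image (Finset.univ.filter fun l => S.lt k i l) S.rank
    ⟨j, by simpa using h⟩
  simp only [Finset.mem_filter, Finset.mem_univ, true_and] at hl hmin
  exact ⟨l, hl, fun ⟨m, h1, h2⟩ => (S.rank_lt h2).not_ge (hmin m h1)⟩

theorem exists_isFirst (hj : S.assign j = k) : ∃ i, S.IsFirst i k := by
  classical
  obtain ⟨l, hl, hmin⟩ := Finset.exists_min_image (Finset.univ.filter fun l => S.assign l = k)
    S.rank ⟨j, by simpa using hj⟩
  simp only [Finset.mem_filter, Finset.mem_univ, true_and] at hl hmin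
  exact ⟨l, S.isFirst_iff.2 ⟨hl, fun i hi => (S.rank_lt hi).not_ge (hmin i (S.lt_assign hi).1)⟩⟩

theorem exists_isLast (hj : S.assign j = k) : ∃ i, S.IsLast i k := by
  classical
  obtain ⟨l, hl, hmax⟩ := Finset.exists_max_image (Finset.univ.filter fun l => S.assign l = k)
    S.rank ⟨j, by simpa using hj⟩
  simp only [Finset.mem_filter, Finset.mem_univ, true_and] at hl hmax
  exact ⟨l, S.isLast_iff.2 ⟨hl, fun i hi => (S.rank_lt hi).not_ge (hmax i (S.lt_assign hi).2)⟩⟩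

theorem completion_of_pred_eq_none (h : S.pred j = none) :
    S.completion j = I.release j (S.assign j) + I.dur j (S.assign j) := by
  rw [completion, startTime, procTime]
  split
  · simp [h]
  · simp_all

theorem completion_of_isNext (h : S.IsNext i j k) :
    S.completion j = max (I.release j k) (S.completion i) + (I.setup i j k + I.dur j k) := by
  obtain rfl := (S.lt_assign h.1).2
  have hp := S.pred_eq_some_iff.2 h
  rw [completion, startTime, procTime]
  split
  · simp_all
  · next i' hi' =>
    obtain rfl : i = i' := Option.some_inj.1 (hp.symm.trans hi')
    simp [hp, completion]

theorem release_add_dur_le_completion (j : J) :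
    I.release j (S.assign j) + I.dur j (S.assign j) ≤ S.completion j := by
  rcases hp : S.pred j with _ | i
  · exact (S.completion_of_pred_eq_none hp).ge
  · rw [S.completion_of_isNext (S.pred_eq_some_iff.1 hp)]
    have := le_max_left (I.release j (S.assign j)) (S.completion i)
    omega

theorem completion_le_of_isNext (hn : S.IsNext l j k) (h : S.lt k i j) :
    S.completion i ≤ S.completion l := by
  induction hr : S.rank j using Nat.strong_induction_on generalizing j l with
  | _ n ih =>
    subst hr
    rcases S.lt_trichotomy (S.lt_assign h).1 (S.lt_assign hn.1).1 with h' | rfl | h'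
    · obtain ⟨m, hm⟩ := S.exists_isNext_left h'
      refine (ih _ (S.rank_lt hn.1) hm h' rfl).trans ?_
      rw [S.completion_of_isNext hm]
      have := le_max_right (I.release l k) (S.completion m)
      omega
    · exact le_rfl
    · exact (hn.2 ⟨i, h', h⟩).elim

theorem completion_add_dur_le (h : S.lt k i j) :
    S.completion i + I.dur j k ≤ S.completion j := by
  obtain ⟨l, hl⟩ := S.exists_isNext_left h
  have h1 := S.completion_le_of_isNext hl h
  have h2 := le_max_right (I.release j k) (S.completion l)
  rw [S.completion_of_isNext hl]
  omega

theorem completion_le_span (j : J) : S.completion j ≤ S.span (S.assign j) := by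
  obtain ⟨l, hl⟩ := S.exists_isLast (j := j) rfl
  have h1 : S.completion l ≤ S.span (S.assign j) := Finset.le_sup (f := S.completion) (by simpa)
  rcases S.lt_trichotomy rfl hl.1 with h | h | h
  · have := S.completion_add_dur_le h
    omega
  · exact h ▸ h1
  · exact ((S.isLast_iff.1 hl).2 j h).elim

theorem span_le {T : ℕ} (h : ∀ j, S.assign j = k → S.completion j ≤ T) : S.span k ≤ T := by
  classical
  refine Finset.sup_le fun j hj => h j ?_
  exact (Finset.mem_filter.1 hj).2.1

theorem completion_le_makespan [Fintype M] (j : J) : S.completion j ≤ S.makespan :=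
  (S.completion_le_span j).trans (Finset.le_sup (f := S.span) (Finset.mem_univ _))

theorem makespan_le [Fintype M] {T : ℕ} (h : ∀ j, S.completion j ≤ T) : S.makespan ≤ T :=
  Finset.sup_le fun _ _ => S.span_le fun j _ => h j

end Schedule

end Sched

/-! ### Lexicographical comparison and multiplicities -/

namespace Sched

/-- `CountLT s t`: at the largest number whose multiplicities in `s` and `t` differ, `s` has the
smaller multiplicity. -/
def CountLT (s t : Multiset ℕ) : Prop :=
  ∃ p, s.count p < t.count p ∧ ∀ q, p < q → s.count q = t.count q

theorem CountLT.trans {s t u : Multiset ℕ} (h₁ : CountLT s t) (h₂ : CountLT t u) :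
    CountLT s u := by
  obtain ⟨p, hp, hp'⟩ := h₁
  obtain ⟨q, hq, hq'⟩ := h₂
  rcases lt_trichotomy p q with hpq | rfl | hpq
  · exact ⟨q, (hp' q hpq).trans_lt hq, fun r hr => (hp' r (hpq.trans hr)).trans (hq' r hr)⟩
  · exact ⟨p, hp.trans hq, fun r hr => (hp' r hr).trans (hq' r hr)⟩
  · exact ⟨p, hp.trans_eq (hq' p hpq), fun r hr => (hp' r hr).trans (hq' r (hpq.trans hr))⟩

theorem CountLT.irrefl (s : Multiset ℕ) : ¬ CountLT s s := fun ⟨_, hp, _⟩ => hp.false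

theorem countLT_of_lex : ∀ {l l' : List ℕ}, l.length = l'.length → l.Pairwise (· ≥ ·) →
    l'.Pairwise (· ≥ ·) → List.Lex (· < ·) l l' → CountLT l l'
  | _, _, hlen, _, _, .nil => by simp at hlen
  | a :: l, _ :: l', hlen, hl, hl', .cons hlex => by
    obtain ⟨p, hp, hp'⟩ := countLT_of_lex (by simpa using hlen) hl.of_cons hl'.of_cons hlex
    simp only [Multiset.coe_count] at hp hp'
    refine ⟨p, ?_, fun q hq => ?_⟩ <;> simp only [Multiset.coe_count, List.count_cons]
    · omega
    · rw [hp' q hq]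
  | a :: l, b :: l', _, hl, hl', .rel hab => by
    rw [List.pairwise_cons] at hl hl'
    have hz : ∀ q, b ≤ q → (a :: l).count q = 0 := by
      intro q hq
      refine List.count_eq_zero.2 fun hmem => ?_
      rcases List.mem_cons.1 hmem with rfl | hmem
      · omega
      · have := hl.1 q hmem
        omega
    refine ⟨b, ?_, fun q hq => ?_⟩ <;> simp only [Multiset.coe_count]
    · rw [hz b le_rfl]
      simp
    · rw [hz q hq.le, eq_comm]
      refine List.count_eq_zero.2 fun hmem => ?_
      rcases List.mem_cons.1 hmem with rfl | hmem
      · omega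
      · have := hl'.1 q hmem
        omega

/-- For multisets of the same size, comparing the non-ascending lists lexicographically is comparing
the multiplicities, from the largest number downwards. -/
theorem lex_sort_iff {s t : Multiset ℕ} (hst : s.card = t.card) :
    List.Lex (· < ·) (s.sort (· ≥ ·)) (t.sort (· ≥ ·)) ↔ CountLT s t := by
  have key : ∀ {s t : Multiset ℕ}, s.card = t.card →
      List.Lex (· < ·) (s.sort (· ≥ ·)) (t.sort (· ≥ ·)) → CountLT s t := by
    intro s t hst hlex
    have := countLT_of_lex (by simpa using hst) (s.pairwise_sort _) (t.pairwise_sort _) hlex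
    rwa [Multiset.sort_eq, Multiset.sort_eq] at this
  refine ⟨key hst, fun hlt => ?_⟩
  rcases trichotomous_of (List.Lex (· < ·)) (s.sort (· ≥ ·)) (t.sort (· ≥ ·)) with h1 | h1 | h1
  · exact h1
  · have : s = t := by rw [← s.sort_eq (· ≥ ·), h1, t.sort_eq]
    exact absurd (this ▸ hlt) (CountLT.irrefl _)
  · exact absurd (hlt.trans (key hst.symm h1)) (CountLT.irrefl _)

variable {J M : Type*} [Fintype M]

/-- Lowering some entries of a tuple makes it smaller: look at the largest original entry that
changes. -/
theorem countLT_of_le {f g : M → ℕ} (hle : ∀ k, f k ≤ g k) (hne : f ≠ g) :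
    CountLT (Finset.univ.val.map f) (Finset.univ.val.map g) := by
  classical
  obtain ⟨k₀, hk₀⟩ := Function.ne_iff.1 hne
  obtain ⟨k, hk, hmax⟩ := Finset.exists_max_image (Finset.univ.filter fun k => f k ≠ g k) g
    ⟨k₀, by simpa using hk₀⟩
  simp only [Finset.mem_filter, Finset.mem_univ, true_and] at hk hmax
  have hcount : ∀ (e : M → ℕ) (p : ℕ),
      (Finset.univ.val.map e).count p = (Finset.univ.filter fun k => p = e k).card :=
    fun e p => Multiset.count_map _ _ _
  refine ⟨g k, ?_, fun q hq => ?_⟩ <;> rw [hcount, hcount]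
  · refine Finset.card_lt_card ((Finset.ssubset_iff_of_subset ?_).2 ⟨k, by simp, by simp [hk.symm]⟩)
    intro l hl
    simp only [Finset.mem_filter, Finset.mem_univ, true_and] at hl ⊢
    by_contra hc
    have h1 := hmax l (by omega)
    have h2 := hle l
    omega
  · congr 1
    ext l
    simp only [Finset.mem_filter, Finset.mem_univ, true_and]
    by_cases hl : f l = g l
    · rw [hl]
    · have h1 := hmax l hl
      have h2 := hle l
      omega

section Cost

open ASP

/-- If each machine `k` has exactly the span atom for `f k` in `X`, then the cost of `X` at level `p`
is `p` times the number of occurrences of `p` in the tuple `f`. -/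
theorem cost_objective {X : Set (Atom J M)} {f : M → ℕ}
    (hX : ∀ z t, .span z t ∈ X ↔ ∃ k, z = .mach k ∧ t = .num (f k)) (p : ℕ) :
    cost objective X p = p * ((Finset.univ.val.map f).count p : ℤ) := by
  classical
  have hset : {wt : ℤ × Const J M | ∃ e ∈ objective, e.level = (p : ℤ) ∧ e.weight = wt.1 ∧
      e.tuple = wt.2 ∧ e.cond ⊆ X} =
      ((Finset.univ.filter fun k => p = f k).image fun k => ((p : ℤ), Const.mach k) :
        Finset (ℤ × Const J M)) := by
    ext ⟨w, c⟩
    simp only [Set.mem_ofPred_eq, Finset.coe_image, Finset.coe_filter, Finset.mem_univ, true_and,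
      Set.mem_image]
    constructor
    · rintro ⟨_, ⟨t, z, rfl⟩, h1, h2, h3, h4⟩
      simp only at h1 h2 h3 h4
      subst h1 h2 h3
      obtain ⟨k, rfl, hk⟩ := (hX _ _).1 (Set.singleton_subset_iff.1 h4)
      exact ⟨k, by simpa using hk, rfl⟩
    · rintro ⟨k, hk, hc⟩
      obtain ⟨rfl, rfl⟩ := Prod.mk.inj hc
      exact ⟨_, ⟨p, .mach k, rfl⟩, rfl, rfl, rfl,
        Set.singleton_subset_iff.2 ((hX _ _).2 ⟨k, rfl, by rw [hk]⟩)⟩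
  rw [cost, hset, finsum_mem_coe_finset, Finset.sum_image (by simp [Set.InjOn])]
  simp only [Finset.sum_const, nsmul_eq_mul, Multiset.count_map, mul_comm]
  rfl

omit [Fintype M] in
theorem cost_objective_of_neg {X : Set (Atom J M)} {f : M → ℕ}
    (hX : ∀ z t, .span z t ∈ X ↔ ∃ k, z = .mach k ∧ t = .num (f k)) {p : ℤ} (hp : p < 0) :
    cost objective X p = 0 := by
  have hset : {wt : ℤ × Const J M | ∃ e ∈ objective, e.level = p ∧ e.weight = wt.1 ∧
      e.tuple = wt.2 ∧ e.cond ⊆ X} = ∅ := by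
    refine Set.eq_empty_of_forall_notMem ?_
    rintro ⟨w, c⟩ ⟨_, ⟨t, z, rfl⟩, rfl, -, -, h4⟩
    obtain ⟨k, -, hk⟩ := (hX _ _).1 (Set.singleton_subset_iff.1 h4)
    simp only [Const.num.injEq] at hk hp
    omega
  rw [cost, hset, finsum_mem_empty]

/-- Level `0` has weight `0`, but the number of zeros in a tuple is determined by the other
multiplicities. -/
theorem better_objective_iff {X Y : Set (Atom J M)} {f g : M → ℕ}
    (hX : ∀ z t, .span z t ∈ X ↔ ∃ k, z = .mach k ∧ t = .num (f k))
    (hY : ∀ z t, .span z t ∈ Y ↔ ∃ k, z = .mach k ∧ t = .num (g k)) :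
    Better objective X Y ↔ CountLT (Finset.univ.val.map f) (Finset.univ.val.map g) := by
  constructor
  · rintro ⟨p, hp, hq⟩
    rcases lt_or_ge p 0 with hneg | hpos
    · rw [cost_objective_of_neg hX hneg, cost_objective_of_neg hY hneg] at hp
      exact hp.false.elim
    lift p to ℕ using hpos
    rw [cost_objective hX, cost_objective hY] at hp
    refine ⟨p, by exact_mod_cast lt_of_mul_lt_mul_left hp (by positivity), fun q hpq => ?_⟩
    have := hq q (by exact_mod_cast hpq)
    rw [cost_objective hX, cost_objective hY] at this
    have hq0 : (q : ℤ) ≠ 0 := by omega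
    exact_mod_cast mul_left_cancel₀ hq0 this
  · rintro ⟨p, hp, hq⟩
    have hp0 : 0 < p := by
      rcases Nat.eq_zero_or_pos p with rfl | h0
      · exfalso
        refine hp.ne ?_
        have hcard : ∀ s : Multiset ℕ, s.card = s.count 0 + (s.filter (· ≠ 0)).card := by
          intro s
          rw [Multiset.count_eq_card_filter_eq, ← Multiset.card_add]
          congr 1
          conv_lhs => rw [← Multiset.filter_add_not (fun x => (0 : ℕ) = x) s]
          congr 2
          ext x
          exact ne_comm
        have hfil : (Finset.univ.val.map f).filter (· ≠ 0) =
            (Finset.univ.val.map g).filter (· ≠ 0) := by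
          ext q
          rcases Nat.eq_zero_or_pos q with rfl | h0
          · rw [Multiset.count_filter_of_neg (by simp), Multiset.count_filter_of_neg (by simp)]
          · rw [Multiset.count_filter_of_pos (p := (· ≠ 0)) h0.ne',
              Multiset.count_filter_of_pos (p := (· ≠ 0)) h0.ne', hq q h0]
        have h1 := hcard (Finset.univ.val.map f)
        have h2 := hcard (Finset.univ.val.map g)
        rw [hfil] at h1
        simp only [Multiset.card_map] at h1 h2
        omega
      · exact h0
    refine ⟨p, ?_, fun q hpq => ?_⟩
    · rw [cost_objective hX, cost_objective hY]
      exact mul_lt_mul_of_pos_left (by exact_mod_cast hp) (by exact_mod_cast hp0)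
    · lift q to ℕ using by omega
      rw [cost_objective hX, cost_objective hY, hq q (by exact_mod_cast hpq)]

end Cost

theorem Schedule.lex_lexMakespan_iff [Fintype J] {I : ProblemInstance J M} {S S' : Schedule I} :
    List.Lex (· < ·) S.lexMakespan S'.lexMakespan ↔
      CountLT (Finset.univ.val.map S.span) (Finset.univ.val.map S'.span) :=
  lex_sort_iff (by simp)

omit [Fintype M] in
theorem Schedule.finite [Finite J] [Finite M] (I : ProblemInstance J M) : Finite (Schedule I) :=
  Finite.of_injective (fun S : Schedule I => (S.assign, S.le)) fun S S' h => by
    obtain ⟨h1, h2⟩ := Prod.mk.inj h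
    exact Schedule.ext h1 h2

/-- Below a schedule that is not optimal there is an optimal one. -/
theorem Schedule.exists_isOptimal_countLT [Fintype J] {I : ProblemInstance J M} {S : Schedule I}
    (hS : ¬ S.IsOptimal) : ∃ S' : Schedule I, S'.IsOptimal ∧
      CountLT (Finset.univ.val.map S'.span) (Finset.univ.val.map S.span) := by
  have := Schedule.finite I
  let r : Schedule I → Schedule I → Prop := fun S S' =>
    CountLT (Finset.univ.val.map S.span) (Finset.univ.val.map S'.span)
  have : IsTrans (Schedule I) r := ⟨fun _ _ _ => CountLT.trans⟩
  have : Std.Irrefl r := ⟨fun _ => CountLT.irrefl _⟩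
  have hwf : WellFounded r := Finite.wellFounded_of_trans_of_irrefl r
  simp only [Schedule.IsOptimal, not_forall, not_not, lex_lexMakespan_iff] at hS ⊢
  obtain ⟨S', hS', hmin⟩ := hwf.has_min {S' | r S' S} hS
  exact ⟨S', fun S'' h => hmin S'' (CountLT.trans h hS') h, hS'⟩

end Sched

/-! ### The atoms and the difference constraints for a schedule -/

namespace Sched

open ASP

variable {J M : Type*}

section Facts

variable {I : ProblemInstance J M} {h : ℕ} {x y z u : Const J M}

@[simp] theorem job_mem_factAtoms : .job x ∈ factAtoms I h ↔ ∃ j, x = .job j := by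
  simp [factAtoms]

@[simp] theorem machine_mem_factAtoms : .machine z ∈ factAtoms I h ↔ ∃ k, z = .mach k := by
  simp [factAtoms]

@[simp] theorem cap_mem_factAtoms :
    .cap z x ∈ factAtoms I h ↔ ∃ j k, k ∈ I.cap j ∧ z = .mach k ∧ x = .job j := by
  simp [factAtoms]

@[simp] theorem duration_mem_factAtoms : .duration x z u ∈ factAtoms I h ↔
    ∃ j k, x = .job j ∧ z = .mach k ∧ u = .num (I.dur j k) := by
  simp [factAtoms]

@[simp] theorem release_mem_factAtoms : .release x z u ∈ factAtoms I h ↔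
    ∃ j k, x = .job j ∧ z = .mach k ∧ u = .num (I.release j k) := by
  simp [factAtoms]

@[simp] theorem setup_mem_factAtoms : .setup x y z u ∈ factAtoms I h ↔
    ∃ i j k, i ≠ j ∧ x = .job i ∧ y = .job j ∧ z = .mach k ∧ u = .num (I.setup i j k) := by
  simp [factAtoms]

@[simp] theorem int_mem_factAtoms : .int u ∈ factAtoms I h ↔ ∃ t : ℕ, t ≤ h ∧ u = .num t := by
  simp [factAtoms]

end Facts

variable {I : ProblemInstance J M} {h : ℕ} {S : Schedule I} {t : M → ℕ}

/-- The atoms, other than difference constraints, of the answer set for the schedule `S` in which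
the bound `t k` is chosen for the span of each machine `k`. -/
def Described (h : ℕ) (S : Schedule I) (t : M → ℕ) : Atom J M → Prop
  | .asg x z => ∃ j k, x = .job j ∧ z = .mach k ∧ S.assign j = k
  | .before x y z => ∃ i j k, x = .job i ∧ y = .job j ∧ z = .mach k ∧ S.lt k i j
  | .next x y z => ∃ i j k, x = .job i ∧ y = .job j ∧ z = .mach k ∧ S.IsNext i j k
  | .first x z => ∃ j k, x = .job j ∧ z = .mach k ∧ S.IsFirst j k
  | .last x z => ∃ j k, x = .job j ∧ z = .mach k ∧ S.IsLast j k
  | .span z u => ∃ k, z = .mach k ∧ u = .num (t k)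
  | .diff _ _ _ => False
  | a => a ∈ factAtoms I h

/-- The answer set for the schedule `S` and the bounds `t` for the spans of the machines. -/
def answer (h : ℕ) (S : Schedule I) (t : M → ℕ) : Set (Atom J M) :=
  {a | Described h S t a} ∪ diffAtoms {a | Described h S t a}

theorem mem_answer_iff {a : Atom J M} (ha : ¬ a.IsDiff) : a ∈ answer h S t ↔ Described h S t a :=
  ⟨fun h' => h'.resolve_right fun h'' => ha (isDiff_of_mem_diffAtoms h''), .inl⟩

theorem mem_answer_iff_of_isDiff {a : Atom J M} (ha : a.IsDiff) :
    a ∈ answer h S t ↔ a ∈ diffAtoms {a | Described h S t a} := by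
  refine ⟨fun h' => h'.resolve_left fun h'' => ?_, .inr⟩
  cases a <;> first | exact h'' | exact ha

theorem diffAtoms_answer_subset : diffAtoms (answer h S t) ⊆ answer h S t :=
  (diffAtoms_congr fun _ ha => (mem_answer_iff ha).1).trans Set.subset_union_right

theorem factAtoms_subset_answer : factAtoms I h ⊆ answer h S t := by
  intro a ha
  have : Described h S t a := by
    cases a <;> first | exact ha | simp [factAtoms] at ha
  exact .inl this

/-- A set of atoms is determined by its other atoms if its difference constraints are exactly the
derived ones. -/
theorem eq_answer {X : Set (Atom J M)} (h₁ : ∀ a, ¬ a.IsDiff → (a ∈ X ↔ Described h S t a))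
    (h₂ : ∀ a, a.IsDiff → (a ∈ X ↔ a ∈ diffAtoms X)) : X = answer h S t := by
  ext a
  by_cases ha : a.IsDiff
  · rw [h₂ a ha, mem_answer_iff_of_isDiff ha]
    exact ⟨fun h => diffAtoms_congr (fun b hb => (h₁ b hb).1) h,
      fun h => diffAtoms_congr (fun b hb => (h₁ b hb).2) h⟩
  · rw [h₁ a ha, mem_answer_iff ha]

section Explicit

variable {x y z u : Const J M}

theorem job_mem_answer : .job x ∈ answer h S t ↔ ∃ j, x = .job j :=
  (mem_answer_iff id).trans job_mem_factAtoms

theorem machine_mem_answer : .machine z ∈ answer h S t ↔ ∃ k, z = .mach k :=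
  (mem_answer_iff id).trans machine_mem_factAtoms

theorem cap_mem_answer :
    .cap z x ∈ answer h S t ↔ ∃ j k, k ∈ I.cap j ∧ z = .mach k ∧ x = .job j :=
  (mem_answer_iff id).trans cap_mem_factAtoms

theorem int_mem_answer : .int u ∈ answer h S t ↔ ∃ t : ℕ, t ≤ h ∧ u = .num t :=
  (mem_answer_iff id).trans int_mem_factAtoms

theorem asg_mem_answer :
    .asg x z ∈ answer h S t ↔ ∃ j k, x = .job j ∧ z = .mach k ∧ S.assign j = k :=
  mem_answer_iff id

theorem before_mem_answer : .before x y z ∈ answer h S t ↔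
    ∃ i j k, x = .job i ∧ y = .job j ∧ z = .mach k ∧ S.lt k i j :=
  mem_answer_iff id

theorem next_mem_answer : .next x y z ∈ answer h S t ↔
    ∃ i j k, x = .job i ∧ y = .job j ∧ z = .mach k ∧ S.IsNext i j k :=
  mem_answer_iff id

theorem first_mem_answer :
    .first x z ∈ answer h S t ↔ ∃ j k, x = .job j ∧ z = .mach k ∧ S.IsFirst j k :=
  mem_answer_iff id

theorem last_mem_answer :
    .last x z ∈ answer h S t ↔ ∃ j k, x = .job j ∧ z = .mach k ∧ S.IsLast j k :=
  mem_answer_iff id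

theorem span_mem_answer : .span z u ∈ answer h S t ↔ ∃ k, z = .mach k ∧ u = .num (t k) :=
  mem_answer_iff id

end Explicit

/-- The difference constraints in the answer set, one clause for each rule. -/
theorem diff_mem_answer {u v : DVar J M} {d : ℤ} : .diff u v d ∈ answer h S t ↔
    (∃ i j k, S.IsNext i j k ∧ u = .zero ∧ v = .c (.job j) ∧
      d = -(I.release j k + I.dur j k + I.setup i j k)) ∨
    (∃ l i j k, S.lt k l j ∧ S.IsNext i j k ∧ u = .c (.job l) ∧ v = .c (.job j) ∧
      d = -(I.dur j k + I.setup i j k)) ∨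
    (∃ j, u = .zero ∧ v = .c (.job j) ∧
      d = -(I.release j (S.assign j) + I.dur j (S.assign j))) ∨
    (∃ j, u = .c (.job j) ∧ v = .cmax ∧ d = 0) ∨
    (∃ i j k, S.lt k i j ∧ u = .c (.job i) ∧ v = .c (.job j) ∧ d = -I.dur j k) ∨
    (∃ j, u = .c (.job j) ∧ v = .zero ∧ d = t (S.assign j)) := by
  rw [mem_answer_iff_of_isDiff (a := .diff u v d) trivial]
  constructor
  · rintro ⟨pos, hr, hp⟩
    rcases hr with ((((⟨j₁, j₃, k, t, d, s, hr⟩ | ⟨j₁, j₂, j₃, k, p, s, hr⟩) | ⟨j₁, k, t, d, hr⟩) |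
      ⟨j, hr⟩) | ⟨j₁, j₂, k, p, hr⟩) | ⟨j, k, s, hr⟩ <;>
    simp only [Rule.disj.injEq, Set.singleton_eq_singleton_iff, Atom.diff.injEq] at hr <;>
    obtain ⟨⟨rfl, rfl, rfl⟩, rfl, -⟩ := hr <;>
    simp only [Set.insert_subset_iff, Set.singleton_subset_iff, Set.mem_ofPred_eq, Described,
      setup_mem_factAtoms, duration_mem_factAtoms, release_mem_factAtoms, job_mem_factAtoms] at hp
    · obtain ⟨-, ⟨i, j, k, rfl, rfl, rfl, hn⟩, ⟨i', j', k', -, h1⟩, ⟨j'', k'', h2⟩, j₃, k₃, h3⟩ := hp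
      simp only [Const.job.injEq, Const.mach.injEq, Const.num.injEq] at h1 h2 h3
      obtain ⟨rfl, rfl, rfl, rfl⟩ := h1
      obtain ⟨rfl, rfl, rfl⟩ := h2
      obtain ⟨rfl, rfl, rfl⟩ := h3
      exact .inl ⟨i, j, k, hn, rfl, rfl, rfl⟩
    · obtain ⟨⟨l, j, k, rfl, rfl, rfl, hl⟩, ⟨i, j', k', rfl, h0, h0', hn⟩, ⟨i', j₂, k₂, -, h1⟩,
        ⟨j₃, k₃, h2⟩⟩ := hp
      simp only [Const.job.injEq, Const.mach.injEq, Const.num.injEq] at h0 h0' h1 h2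
      subst h0 h0'
      obtain ⟨rfl, rfl, rfl, rfl⟩ := h1
      obtain ⟨rfl, rfl, rfl⟩ := h2
      exact .inr (.inl ⟨l, i, j, k, hl, hn, rfl, rfl, rfl⟩)
    · obtain ⟨⟨j, k, rfl, rfl, rfl⟩, ⟨j₂, k₂, h1⟩, ⟨j₃, k₃, h2⟩⟩ := hp
      simp only [Const.job.injEq, Const.mach.injEq, Const.num.injEq] at h1 h2
      obtain ⟨rfl, rfl, rfl⟩ := h1
      obtain ⟨rfl, rfl, rfl⟩ := h2
      exact .inr (.inr (.inl ⟨j, rfl, rfl, rfl⟩))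
    · obtain ⟨j, rfl⟩ := hp
      exact .inr (.inr (.inr (.inl ⟨j, rfl, rfl, rfl⟩)))
    · obtain ⟨⟨i, j, k, rfl, rfl, rfl, hl⟩, ⟨j₂, k₂, h1⟩⟩ := hp
      simp only [Const.job.injEq, Const.mach.injEq, Const.num.injEq] at h1
      obtain ⟨rfl, rfl, rfl⟩ := h1
      exact .inr (.inr (.inr (.inr (.inl ⟨i, j, k, hl, rfl, rfl, rfl⟩))))
    · obtain ⟨⟨j, k, rfl, rfl, rfl⟩, ⟨k₂, h1⟩⟩ := hp
      simp only [Const.mach.injEq, Const.num.injEq] at h1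
      obtain ⟨rfl, rfl⟩ := h1
      exact .inr (.inr (.inr (.inr (.inr ⟨j, rfl, rfl, rfl⟩))))
  · rintro (⟨i, j, k, hn, rfl, rfl, rfl⟩ | ⟨l, i, j, k, hl, hn, rfl, rfl, rfl⟩ | ⟨j, rfl, rfl, rfl⟩ |
      ⟨j, rfl, rfl, rfl⟩ | ⟨i, j, k, hl, rfl, rfl, rfl⟩ | ⟨j, rfl, rfl, rfl⟩)
    · obtain ⟨-, hj⟩ := S.lt_assign hn.1
      refine ⟨_, .inl (.inl (.inl (.inl (.inl ⟨.job j, .job i, .mach k, _, _, _, rfl⟩)))), ?_⟩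
      simp [Set.insert_subset_iff, Described, hj, hn, hn.1.2]
    · refine ⟨_, .inl (.inl (.inl (.inl (.inr ⟨.job j, .job l, .job i, .mach k, _, _, rfl⟩)))), ?_⟩
      simp [Set.insert_subset_iff, Described, hl, hn, hn.1.2]
    · refine ⟨_, .inl (.inl (.inl (.inr ⟨.job j, .mach (S.assign j), _, _, rfl⟩))), ?_⟩
      simp [Set.insert_subset_iff, Described]
    · refine ⟨_, .inl (.inl (.inr ⟨.job j, rfl⟩)), ?_⟩
      simp [Described]
    · refine ⟨_, .inl (.inr ⟨.job j, .job i, .mach k, _, rfl⟩), ?_⟩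
      simp [Set.insert_subset_iff, Described, hl]
    · refine ⟨_, .inr ⟨.job j, .mach (S.assign j), _, rfl⟩, ?_⟩
      simp [Set.insert_subset_iff, Described]

section Solutions

variable [Fintype J]

/-- The completion times are below every solution of the difference constraints, by induction along
the sequence of jobs on a machine. -/
theorem completion_le_of_solves {ν : DVar J M → ℤ} (hν : Solves ν (answer h S t)) (j : J) :
    S.completion j ≤ ν (.c (.job j)) := by
  induction hr : S.rank j using Nat.strong_induction_on generalizing j with
  | _ n ih =>
    subst hr
    rcases hp : S.pred j with _ | i
    · rw [S.completion_of_pred_eq_none hp]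
      have h1 := hν.2 _ _ _ (diff_mem_answer.2 (.inr (.inr (.inl ⟨j, rfl, rfl, rfl⟩))))
      rw [hν.1] at h1
      push_cast
      omega
    · have hn := S.isNext_of_pred hp
      have h0 := ih _ (S.rank_lt hn.1) i rfl
      have h1 := hν.2 _ _ _ (diff_mem_answer.2 (.inl ⟨i, j, _, hn, rfl, rfl, rfl⟩))
      have h2 := hν.2 _ _ _ (diff_mem_answer.2
        (.inr (.inl ⟨i, i, j, _, hn.1, hn, rfl, rfl, rfl⟩)))
      rw [hν.1] at h1
      rw [S.completion_of_isNext hn]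
      push_cast
      omega

/-- Solvability of the constraints forces the chosen bounds above the machine spans. -/
theorem span_le_of_solves {ν : DVar J M → ℤ} (hν : Solves ν (answer h S t)) (k : M) :
    S.span k ≤ t k := by
  refine S.span_le fun j hj => ?_
  have h1 := completion_le_of_solves hν j
  have h2 := hν.2 _ _ _ (diff_mem_answer.2
    (.inr (.inr (.inr (.inr (.inr ⟨j, rfl, rfl, rfl⟩))))))
  rw [hν.1, hj] at h2
  omega

variable [Fintype M]

/-- The values of the variables in the schedule `S`; variables `c(x)` where `x` is not a job do not
occur and get an arbitrary value. -/
noncomputable def Schedule.values (S : Schedule I) : DVar J M → ℤ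
  | .zero => 0
  | .c (.job j) => S.completion j
  | .c _ => 0
  | .cmax => S.makespan

theorem solves_values (ht : ∀ k, S.span k ≤ t k) : Solves S.values (answer h S t) := by
  refine ⟨rfl, fun u v d hd => ?_⟩
  rcases diff_mem_answer.1 hd with ⟨i, j, k, hn, rfl, rfl, rfl⟩ | ⟨l, i, j, k, hl, hn, rfl, rfl, rfl⟩ |
    ⟨j, rfl, rfl, rfl⟩ | ⟨j, rfl, rfl, rfl⟩ | ⟨i, j, k, hl, rfl, rfl, rfl⟩ | ⟨j, rfl, rfl, rfl⟩ <;>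
  simp only [Schedule.values]
  · have := S.completion_of_isNext hn
    omega
  · have h1 := S.completion_of_isNext hn
    have h2 := S.completion_le_of_isNext hn hl
    omega
  · have := S.release_add_dur_le_completion j
    omega
  · have := S.completion_le_makespan j
    omega
  · have := S.completion_add_dur_le hl
    omega
  · have h1 := S.completion_le_span j
    have h2 := ht (S.assign j)
    omega

theorem isLeastSolution_values (ht : ∀ k, S.span k ≤ t k) :
    IsLeastSolution S.values (answer h S t) := by
  refine ⟨solves_values ht, fun ν hν u hu => ?_⟩
  have hcmax : ∀ j : J, (S.makespan : ℤ) ≤ ν .cmax := by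
    have hc : ∀ j, (S.completion j : ℤ) ≤ ν .cmax := by
      intro j
      have h1 := completion_le_of_solves hν j
      have h2 := hν.2 _ _ _ (diff_mem_answer.2 (.inr (.inr (.inr (.inl ⟨j, rfl, rfl, rfl⟩)))))
      omega
    intro j
    have h0 : 0 ≤ ν .cmax := (Int.natCast_nonneg _).trans (hc j)
    have := S.makespan_le (T := (ν .cmax).toNat) fun j => by
      have := hc j
      omega
    omega
  have hzero : S.values .zero ≤ ν .zero := hν.1.ge
  obtain ⟨v, d, hd | hd⟩ := hu <;>
  rcases diff_mem_answer.1 hd with ⟨i, j, k, hn, rfl, rfl, rfl⟩ |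
    ⟨l, i, j, k, hl, hn, rfl, rfl, rfl⟩ | ⟨j, rfl, rfl, rfl⟩ | ⟨j, rfl, rfl, rfl⟩ |
    ⟨i, j, k, hl, rfl, rfl, rfl⟩ | ⟨j, rfl, rfl, rfl⟩ <;>
  first | exact hzero | exact completion_le_of_solves hν _ | exact hcmax j

theorem encodes_answer : Encodes S (answer h S S.span) where
  asg_iff _ _ := asg_mem_answer
  before_iff _ _ _ := before_mem_answer
  next_iff _ _ _ := next_mem_answer
  first_iff _ _ := first_mem_answer
  last_iff _ _ := last_mem_answer
  span_iff _ _ := span_mem_answer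
  values := ⟨S.values, isLeastSolution_values fun _ => le_rfl, fun _ => rfl, fun _ => rfl⟩

end Solutions

end Sched

/-! ### The answer sets of the program -/

namespace Sched

open ASP

variable {J M : Type*} [LinearOrder (Const J M)] [Fintype J] {I : ProblemInstance J M} {h : ℕ}

theorem programSat_answer {S : Schedule I} {t : M → ℕ} (ht : ∀ k, t k ≤ h) :
    ProgramSat I h (answer h S t) where
  facts := factAtoms_subset_answer
  asg x hx := by
    obtain ⟨j, rfl⟩ := job_mem_answer.1 hx
    refine ⟨.mach (S.assign j), ⟨cap_mem_answer.2 ⟨j, _, S.assign_cap j, rfl, rfl⟩,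
      asg_mem_answer.2 ⟨j, _, rfl, rfl, rfl⟩⟩, ?_⟩
    rintro z ⟨-, hz⟩
    obtain ⟨j', k, hj, rfl, rfl⟩ := asg_mem_answer.1 hz
    rw [Const.job.inj hj]
  before x y z hxy hx hy := by
    obtain ⟨i, k, rfl, rfl, hi⟩ := asg_mem_answer.1 hx
    obtain ⟨j, k', rfl, hk, hj⟩ := asg_mem_answer.1 hy
    obtain rfl := Const.mach.inj hk
    rcases S.lt_trichotomy hi hj with h1 | rfl | h1
    · exact .inl (before_mem_answer.2 ⟨_, _, _, rfl, rfl, rfl, h1⟩)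
    · exact (lt_irrefl _ hxy).elim
    · exact .inr (before_mem_answer.2 ⟨_, _, _, rfl, rfl, rfl, h1⟩)
  first y z hy := by
    obtain ⟨j, k, rfl, rfl, hj⟩ := asg_mem_answer.1 hy
    obtain ⟨i, hi⟩ := S.exists_isFirst hj
    refine ⟨.job i, ⟨asg_mem_answer.2 ⟨_, _, rfl, rfl, hi.1⟩,
      first_mem_answer.2 ⟨_, _, rfl, rfl, hi⟩⟩, ?_⟩
    rintro x ⟨-, hx⟩
    obtain ⟨i', k', rfl, hk, hi'⟩ := first_mem_answer.1 hx
    obtain rfl := Const.mach.inj hk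
    rw [hi.unique hi']
  last y z hy := by
    obtain ⟨j, k, rfl, rfl, hj⟩ := asg_mem_answer.1 hy
    obtain ⟨i, hi⟩ := S.exists_isLast hj
    refine ⟨.job i, ⟨asg_mem_answer.2 ⟨_, _, rfl, rfl, hi.1⟩,
      last_mem_answer.2 ⟨_, _, rfl, rfl, hi⟩⟩, ?_⟩
    rintro x ⟨-, hx⟩
    obtain ⟨i', k', rfl, hk, hi'⟩ := last_mem_answer.1 hx
    obtain rfl := Const.mach.inj hk
    rw [hi.unique hi']
  next_in y z hy hf := by
    obtain ⟨j, k, rfl, rfl, hj⟩ := asg_mem_answer.1 hy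
    have hnf : ¬ S.IsFirst j k := fun h' => hf (first_mem_answer.2 ⟨_, _, rfl, rfl, h'⟩)
    rw [S.isFirst_iff] at hnf
    push Not at hnf
    obtain ⟨i, hi⟩ := hnf hj
    obtain ⟨l, hl⟩ := S.exists_isNext_left hi
    refine ⟨.job l, ⟨before_mem_answer.2 ⟨_, _, _, rfl, rfl, rfl, hl.1⟩,
      next_mem_answer.2 ⟨_, _, _, rfl, rfl, rfl, hl⟩⟩, ?_⟩
    rintro x ⟨-, hx⟩
    obtain ⟨l', j', k', rfl, hj', hk, hl'⟩ := next_mem_answer.1 hx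
    obtain rfl := Const.mach.inj hk
    obtain rfl := Const.job.inj hj'
    rw [hl.unique_left hl']
  next_out x z hx hf := by
    obtain ⟨j, k, rfl, rfl, hj⟩ := asg_mem_answer.1 hx
    have hnf : ¬ S.IsLast j k := fun h' => hf (last_mem_answer.2 ⟨_, _, rfl, rfl, h'⟩)
    rw [S.isLast_iff] at hnf
    push Not at hnf
    obtain ⟨i, hi⟩ := hnf hj
    obtain ⟨l, hl⟩ := S.exists_isNext_right hi
    refine ⟨.job l, ⟨before_mem_answer.2 ⟨_, _, _, rfl, rfl, rfl, hl.1⟩,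
      next_mem_answer.2 ⟨_, _, _, rfl, rfl, rfl, hl⟩⟩, ?_⟩
    rintro y ⟨-, hy⟩
    obtain ⟨j', l', k', hj', rfl, hk, hl'⟩ := next_mem_answer.1 hy
    obtain rfl := Const.mach.inj hk
    obtain rfl := Const.job.inj hj'
    rw [hl.unique_right hl']
  first_ok x y z hf hb := by
    obtain ⟨j, k, rfl, rfl, hj⟩ := first_mem_answer.1 hf
    obtain ⟨i, j', k', rfl, hj', hk, hb⟩ := before_mem_answer.1 hb
    obtain rfl := Const.mach.inj hk
    obtain rfl := Const.job.inj hj'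
    exact (S.isFirst_iff.1 hj).2 _ hb
  last_ok x y z hf hb := by
    obtain ⟨j, k, rfl, rfl, hj⟩ := last_mem_answer.1 hf
    obtain ⟨j', i, k', hj', rfl, hk, hb⟩ := before_mem_answer.1 hb
    obtain rfl := Const.mach.inj hk
    obtain rfl := Const.job.inj hj'
    exact (S.isLast_iff.1 hj).2 _ hb
  span z hz := by
    obtain ⟨k, rfl⟩ := machine_mem_answer.1 hz
    refine ⟨.num (t k), ⟨int_mem_answer.2 ⟨_, ht k, rfl⟩, span_mem_answer.2 ⟨k, rfl, rfl⟩⟩, ?_⟩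
    rintro u ⟨-, hu⟩
    obtain ⟨k', hk, rfl⟩ := span_mem_answer.1 hu
    rw [Const.mach.inj hk]
  diffs := diffAtoms_answer_subset

/-- The atoms of `answer h S t` can be derived one stratum after another from the facts, so that
none of them can be missing in a model of the reduct. -/
theorem isAnswerSet_answer {S : Schedule I} {t : M → ℕ} (ht : ∀ k, t k ≤ h) :
    IsAnswerSet (program I h) (answer h S t) := by
  refine ⟨isModel_reduct_self_iff.2 (sat_program_iff.2 (programSat_answer ht)), fun Y hY hYX => ?_⟩
  have hsub : ∀ r : Rule (Atom J M), r ∈ ruleAsg ∨ r ∈ ruleBefore ∨ r ∈ ruleFirst ∨ r ∈ ruleLast ∨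
      r ∈ ruleNextIn ∨ r ∈ ruleSpan → r ∈ program I h := by
    intro r hr
    simp only [program, Set.mem_union]
    tauto
  have hfacts : factAtoms I h ⊆ Y := by
    intro a ha
    have hmem : fact a ∈ program I h := by
      simp only [program, Set.mem_union]
      exact .inl (.inl (.inl (.inl (.inl (.inl (.inl (.inl (.inl (.inl (.inl (.inl (.inl
        (.inl (.inl ⟨a, ha, rfl⟩))))))))))))))
    obtain ⟨b, rfl, hb⟩ := hY.disj_mem hmem (Set.empty_disjoint _) (Set.empty_subset _)
    exact hb
  have hasg : ∀ x z, .asg x z ∈ answer h S t → .asg x z ∈ Y := by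
    intro x z hx
    obtain ⟨j, k, rfl, rfl, rfl⟩ := asg_mem_answer.1 hx
    refine hY.choice_mem (hsub _ (.inl ⟨.job j, rfl⟩)) (Set.empty_disjoint _) ⟨_, rfl⟩ hx ?_ ?_
    · exact Set.singleton_subset_iff.2 (hfacts (by simp [S.assign_cap j]))
    · exact Set.singleton_subset_iff.2 (hfacts (by simp))
  have hbefore : ∀ x y z, .before x y z ∈ answer h S t → .before x y z ∈ Y := by
    intro x y z hx
    obtain ⟨i, j, k, rfl, rfl, rfl, hij⟩ := before_mem_answer.1 hx
    obtain ⟨hi, hj⟩ := S.lt_assign hij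
    have hyi := hasg _ _ (asg_mem_answer.2 ⟨i, k, rfl, rfl, hi⟩)
    have hyj := hasg _ _ (asg_mem_answer.2 ⟨j, k, rfl, rfl, hj⟩)
    -- the other atom of the head is not available, since it is not in the larger set
    have hno : .before (.job j) (.job i) (.mach k) ∉ Y := by
      intro hy
      obtain ⟨j', i', k', h1, h2, h3, hji⟩ := before_mem_answer.1 (hYX hy)
      obtain rfl := Const.job.inj h1
      obtain rfl := Const.job.inj h2
      obtain rfl := Const.mach.inj h3
      exact S.lt_asymm hij hji
    have hne : (Const.job i : Const J M) ≠ .job j := fun h' => hij.2 (Const.job.inj h')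
    rcases lt_or_gt_of_ne hne with hlt | hlt
    · obtain ⟨a, rfl | rfl, ha⟩ := hY.disj_mem (hsub _ (.inr (.inl ⟨_, _, .mach k, hlt, rfl⟩)))
        (Set.empty_disjoint _) (by simp [Set.insert_subset_iff, *])
      exacts [ha, (hno ha).elim]
    · obtain ⟨a, rfl | rfl, ha⟩ := hY.disj_mem (hsub _ (.inr (.inl ⟨_, _, .mach k, hlt, rfl⟩)))
        (Set.empty_disjoint _) (by simp [Set.insert_subset_iff, *])
      exacts [(hno ha).elim, ha]
  have hdescribed : ∀ a, ¬ a.IsDiff → a ∈ answer h S t → a ∈ Y := by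
    intro a hnd ha
    cases a with
    | asg x z => exact hasg x z ha
    | before x y z => exact hbefore x y z ha
    | first x z =>
      obtain ⟨j, k, rfl, rfl, hj⟩ := first_mem_answer.1 ha
      have := hasg _ _ (asg_mem_answer.2 ⟨j, k, rfl, rfl, hj.1⟩)
      exact hY.choice_mem (hsub _ (.inr (.inr (.inl ⟨.job j, .mach k, rfl⟩)))) (Set.empty_disjoint _)
        ⟨_, rfl⟩ ha (Set.singleton_subset_iff.2 this) (Set.singleton_subset_iff.2 this)
    | last x z =>
      obtain ⟨j, k, rfl, rfl, hj⟩ := last_mem_answer.1 ha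
      have := hasg _ _ (asg_mem_answer.2 ⟨j, k, rfl, rfl, hj.1⟩)
      exact hY.choice_mem (hsub _ (.inr (.inr (.inr (.inl ⟨.job j, .mach k, rfl⟩)))))
        (Set.empty_disjoint _) ⟨_, rfl⟩ ha (Set.singleton_subset_iff.2 this)
        (Set.singleton_subset_iff.2 this)
    | next x y z =>
      obtain ⟨i, j, k, rfl, rfl, rfl, hn⟩ := next_mem_answer.1 ha
      have h1 := hasg _ _ (asg_mem_answer.2 ⟨j, k, rfl, rfl, (S.lt_assign hn.1).2⟩)
      have h2 := hbefore _ _ _ (before_mem_answer.2 ⟨i, j, k, rfl, rfl, rfl, hn.1⟩)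
      refine hY.choice_mem (hsub _ (.inr (.inr (.inr (.inr (.inl ⟨.job j, .mach k, rfl⟩))))))
        (Set.disjoint_singleton_left.2 fun hf => ?_) ⟨_, rfl⟩ ha (Set.singleton_subset_iff.2 h2)
        (Set.singleton_subset_iff.2 h1)
      obtain ⟨j', k', h1, h2, hf⟩ := first_mem_answer.1 hf
      obtain rfl := Const.job.inj h1
      obtain rfl := Const.mach.inj h2
      exact (S.isFirst_iff.1 hf).2 _ hn.1
    | span z u =>
      obtain ⟨k, rfl, rfl⟩ := span_mem_answer.1 ha
      refine hY.choice_mem (hsub _ (.inr (.inr (.inr (.inr (.inr ⟨.mach k, rfl⟩))))))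
        (Set.empty_disjoint _) ⟨_, rfl⟩ ha ?_ ?_
      · exact Set.singleton_subset_iff.2 (hfacts (by simp [ht k]))
      · exact Set.singleton_subset_iff.2 (hfacts (by simp))
    | diff u v d => exact (hnd trivial).elim
    | _ => exact hfacts ((mem_answer_iff hnd).1 ha)
  intro a ha
  by_cases hd : a.IsDiff
  · obtain ⟨pos, hr, hp⟩ := diffAtoms_congr (B := {a | Described h S t a}) (C := Y)
      (fun b hb hb' => hdescribed b hb (.inl hb')) ((mem_answer_iff_of_isDiff hd).1 ha)
    obtain ⟨b, rfl, hb⟩ := hY.disj_mem (diffRules_subset_program hr) (Set.empty_disjoint _) hp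
    exact hb
  · exact hdescribed a hd ha

/-- Every answer set with satisfiable difference constraints comes from a schedule.

The constraint of `before(i,j,k)` forces `c(i) < c(j)`, so that `before` is acyclic and hence, being
a tournament on the jobs of a machine, a linear order.  The atoms over `next` form a bijection from
the jobs other than the last one to those other than the first one, along which jobs move up in that
order; this is possible only if each job is mapped to its immediate successor. -/
theorem exists_eq_answer {X : Set (Atom J M)} (hX : IsAnswerSet (program I h) X)
    {ν : DVar J M → ℤ} (hν : Solves ν X) :
    ∃ (S : Schedule I) (t : M → ℕ), (∀ k, t k ≤ h) ∧ X = answer h S t := by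
  have hs := sat_program_iff.1 (isModel_reduct_self_iff.1 hX.prop)
  have hreason : ∀ {a}, a ∈ X → Reason I h X a := fun ha => reason_of_mem hX ha
  have hbefore_asg : ∀ {x y z}, .before x y z ∈ X → .asg x z ∈ X ∧ .asg y z ∈ X :=
    fun hb => ⟨(hreason hb).1, (hreason hb).2.1⟩
  have hasg_form : ∀ {x z}, .asg x z ∈ X → ∃ j k, x = .job j ∧ z = .mach k ∧ k ∈ I.cap j := by
    intro x z hx
    have : .cap z x ∈ factAtoms I h := hreason (hreason hx).2
    obtain ⟨j, k, hk, rfl, rfl⟩ := cap_mem_factAtoms.1 this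
    exact ⟨j, k, rfl, rfl, hk⟩
  have hassign : ∀ j : J, ∃ k : M, .asg (.job j) (.mach k) ∈ X ∧ k ∈ I.cap j := by
    intro j
    obtain ⟨z, ⟨-, hz⟩, -⟩ := hs.asg (.job j) (hs.facts (by simp))
    obtain ⟨j', k, hj, rfl, hk⟩ := hasg_form hz
    obtain rfl := Const.job.inj hj
    exact ⟨k, hz, hk⟩
  choose assign hassign hcap using hassign
  have hasg_iff : ∀ {j k}, .asg (.job j) (.mach k) ∈ X ↔ assign j = k := by
    intro j k
    refine ⟨fun h' => ?_, fun h' => h' ▸ hassign j⟩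
    exact Const.mach.inj ((hs.asg (.job j) (hs.facts (by simp))).unique
      ⟨(hreason (hassign j)).2, hassign j⟩ ⟨(hreason h').2, h'⟩)
  have hvalue : ∀ {i j k}, .before (.job i) (.job j) (.mach k) ∈ X →
      ν (.c (.job i)) < ν (.c (.job j)) := by
    intro i j k hb
    have hd : .diff (.c (.job i)) (.c (.job j)) (-(I.dur j k : ℤ)) ∈ X := by
      refine hs.diffs ⟨_, .inl (.inr ⟨.job j, .job i, .mach k, _, rfl⟩), ?_⟩
      simpa [Set.insert_subset_iff, hb] using hs.facts (by simp)
    have h1 := hν.2 _ _ _ hd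
    have h2 := I.dur_pos j k
    omega
  have htotal : ∀ {i j k}, assign i = k → assign j = k → i ≠ j →
      .before (.job i) (.job j) (.mach k) ∈ X ∨ .before (.job j) (.job i) (.mach k) ∈ X := by
    intro i j k hi hj hij
    rcases lt_or_gt_of_ne (fun h' => hij (Const.job.inj h') : (Const.job i : Const J M) ≠ .job j)
      with hlt | hlt
    · exact hs.before _ _ _ hlt (hasg_iff.2 hi) (hasg_iff.2 hj)
    · exact (hs.before _ _ _ hlt (hasg_iff.2 hj) (hasg_iff.2 hi)).symm
  let S : Schedule I :=
    { assign := assign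
      assign_cap := hcap
      le := fun k i j => assign i = k ∧ assign j = k ∧
        (i = j ∨ .before (.job i) (.job j) (.mach k) ∈ X)
      le_assigned := fun k i j h' => ⟨h'.1, h'.2.1⟩
      le_refl := fun k j h' => ⟨h', h', .inl rfl⟩
      le_antisymm := by
        rintro k i j ⟨-, -, rfl | h1⟩ ⟨-, -, h2 | h2⟩
        · rfl
        · rfl
        · exact h2.symm
        · exact ((hvalue h1).trans (hvalue h2)).false.elim
      le_trans := by
        rintro k i j l ⟨hi, hj, rfl | h1⟩ ⟨-, hl, rfl | h2⟩
        · exact ⟨hi, hl, .inl rfl⟩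
        · exact ⟨hi, hl, .inr h2⟩
        · exact ⟨hi, hl, .inr h1⟩
        · have hlt := (hvalue h1).trans (hvalue h2)
          rcases eq_or_ne i l with rfl | hil
          · exact hlt.false.elim
          · exact ⟨hi, hl, .inr ((htotal hi hl hil).resolve_right
              fun h3 => (hlt.trans (hvalue h3)).false)⟩
      le_total := by
        intro k i j hi hj
        rcases eq_or_ne i j with rfl | hij
        · exact .inl ⟨hi, hj, .inl rfl⟩
        · exact (htotal hi hj hij).imp (fun h' => ⟨hi, hj, .inr h'⟩)
            fun h' => ⟨hj, hi, .inr h'⟩ }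
  have hbefore_iff : ∀ {i j k}, .before (.job i) (.job j) (.mach k) ∈ X ↔ S.lt k i j := by
    intro i j k
    constructor
    · intro hb
      obtain ⟨hi, hj⟩ := hbefore_asg hb
      refine ⟨⟨hasg_iff.1 hi, hasg_iff.1 hj, .inr hb⟩, ?_⟩
      rintro rfl
      exact (hvalue hb).false
    · rintro ⟨⟨-, -, h1⟩, h2⟩
      exact h1.resolve_left h2
  have hbefore_form : ∀ {x y z}, .before x y z ∈ X →
      ∃ i j k, x = .job i ∧ y = .job j ∧ z = .mach k ∧ S.lt k i j := by
    intro x y z hb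
    obtain ⟨i, k, rfl, rfl, -⟩ := hasg_form (hbefore_asg hb).1
    obtain ⟨j, k', rfl, hk, -⟩ := hasg_form (hbefore_asg hb).2
    exact ⟨i, j, k, rfl, rfl, rfl, hbefore_iff.1 hb⟩
  have hfirst_of : ∀ {j k}, .first (.job j) (.mach k) ∈ X → S.IsFirst j k := by
    intro j k hf
    exact S.isFirst_iff.2 ⟨hasg_iff.1 (hreason hf),
      fun i hi => hs.first_ok _ _ _ hf (hbefore_iff.2 hi)⟩
  have hfirst : ∀ {j k}, .first (.job j) (.mach k) ∈ X ↔ S.IsFirst j k := by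
    intro j k
    refine ⟨hfirst_of, fun hj => ?_⟩
    obtain ⟨x, ⟨hx, hf⟩, -⟩ := hs.first _ _ (hasg_iff.2 hj.1)
    obtain ⟨i, k', rfl, hk, -⟩ := hasg_form hx
    exact hj.unique (hfirst_of hf) ▸ hf
  have hlast_of : ∀ {j k}, .last (.job j) (.mach k) ∈ X → S.IsLast j k := by
    intro j k hf
    exact S.isLast_iff.2 ⟨hasg_iff.1 (hreason hf),
      fun i hi => hs.last_ok _ _ _ hf (hbefore_iff.2 hi)⟩
  have hlast : ∀ {j k}, .last (.job j) (.mach k) ∈ X ↔ S.IsLast j k := by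
    intro j k
    refine ⟨hlast_of, fun hj => ?_⟩
    obtain ⟨x, ⟨hx, hf⟩, -⟩ := hs.last _ _ (hasg_iff.2 hj.1)
    obtain ⟨i, k', rfl, hk, -⟩ := hasg_form hx
    exact hj.unique (hlast_of hf) ▸ hf
  have hnext_lt : ∀ {i j k}, .next (.job i) (.job j) (.mach k) ∈ X → S.lt k i j :=
    fun hn => hbefore_iff.1 (hreason hn)
  have hin_unique : ∀ {i i' j k}, .next (.job i) (.job j) (.mach k) ∈ X →
      .next (.job i') (.job j) (.mach k) ∈ X → i = i' := by
    intro i i' j k h1 h2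
    have hlt := hnext_lt h1
    refine Const.job.inj ((hs.next_in _ _ (hasg_iff.2 (S.lt_assign hlt).2) fun hf => ?_).unique
      ⟨hreason h1, h1⟩ ⟨hreason h2, h2⟩)
    exact (S.isFirst_iff.1 (hfirst_of hf)).2 _ hlt
  have hout_unique : ∀ {i j j' k}, .next (.job i) (.job j) (.mach k) ∈ X →
      .next (.job i) (.job j') (.mach k) ∈ X → j = j' := by
    intro i j j' k h1 h2
    have hlt := hnext_lt h1
    refine Const.job.inj ((hs.next_out _ _ (hasg_iff.2 (S.lt_assign hlt).1) fun hf => ?_).unique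
      ⟨hreason h1, h1⟩ ⟨hreason h2, h2⟩)
    exact (S.isLast_iff.1 (hlast_of hf)).2 _ hlt
  have hin_exists : ∀ {i j k}, S.lt k i j → ∃ l, .next (.job l) (.job j) (.mach k) ∈ X := by
    intro i j k hlt
    obtain ⟨x, ⟨hb, hn⟩, -⟩ := hs.next_in _ _ (hasg_iff.2 (S.lt_assign hlt).2)
      fun hf => (S.isFirst_iff.1 (hfirst_of hf)).2 _ hlt
    obtain ⟨l, -, -, rfl, -⟩ := hbefore_form hb
    exact ⟨l, hn⟩
  have hout_exists : ∀ {i j k}, S.lt k i j → ∃ l, .next (.job i) (.job l) (.mach k) ∈ X := by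
    intro i j k hlt
    obtain ⟨y, ⟨hb, hn⟩, -⟩ := hs.next_out _ _ (hasg_iff.2 (S.lt_assign hlt).1)
      fun hf => (S.isLast_iff.1 (hlast_of hf)).2 _ hlt
    obtain ⟨-, l, -, -, rfl, -⟩ := hbefore_form hb
    exact ⟨l, hn⟩
  have hnext_of : ∀ (i j k), S.IsNext i j k → .next (.job i) (.job j) (.mach k) ∈ X := by
    intro i j k
    induction hr : S.rank j using Nat.strong_induction_on generalizing i j with
    | _ n ih =>
      subst hr
      intro hij
      obtain ⟨l, hl⟩ := hin_exists hij.1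
      rcases S.lt_trichotomy (S.lt_assign (hnext_lt hl)).1 (S.lt_assign hij.1).1 with h' | rfl | h'
      · -- the successor of `l` comes before `j`, so that `l` has a second `next` atom by induction
        obtain ⟨m, hm⟩ := S.exists_isNext_right h'
        have hmj : S.lt k m j := by
          rcases S.lt_trichotomy (S.lt_assign hm.1).2 (S.lt_assign hij.1).1 with h3 | rfl | h3
          exacts [S.lt_trans h3 hij.1, hij.1, (hm.2 ⟨i, h', h3⟩).elim]
        exact (hmj.2 (hout_unique (ih _ (S.rank_lt hmj) l m rfl hm) hl)).elim
      · exact hl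
      · exact (hij.2 ⟨l, h', hnext_lt hl⟩).elim
  have hnext : ∀ {i j k}, .next (.job i) (.job j) (.mach k) ∈ X ↔ S.IsNext i j k := by
    intro i j k
    refine ⟨fun hn => ?_, hnext_of i j k⟩
    obtain ⟨l, hl⟩ := S.exists_isNext_left (hnext_lt hn)
    exact hin_unique (hnext_of _ _ _ hl) hn ▸ hl
  have hspan : ∀ k : M, ∃ t : ℕ, t ≤ h ∧ .span (.mach k) (.num t) ∈ X := by
    intro k
    obtain ⟨u, ⟨hu, hsp⟩, -⟩ := hs.span (.mach k) (hs.facts (by simp))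
    obtain ⟨t, ht, rfl⟩ := int_mem_factAtoms.1 (hreason hu : .int u ∈ factAtoms I h)
    exact ⟨t, ht, hsp⟩
  choose t ht hspan using hspan
  refine ⟨S, t, ht, eq_answer (fun a ha => ?_) fun a ha => ?_⟩
  · cases a with
    | asg x z =>
      refine ⟨fun hx => ?_, ?_⟩
      · obtain ⟨j, k, rfl, rfl, -⟩ := hasg_form hx
        exact ⟨j, k, rfl, rfl, hasg_iff.1 hx⟩
      · rintro ⟨j, k, rfl, rfl, hj⟩
        exact hasg_iff.2 hj
    | before x y z =>
      refine ⟨hbefore_form, ?_⟩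
      rintro ⟨i, j, k, rfl, rfl, rfl, hb⟩
      exact hbefore_iff.2 hb
    | first x z =>
      refine ⟨fun hx => ?_, ?_⟩
      · obtain ⟨j, k, rfl, rfl, -⟩ := hasg_form (hreason hx)
        exact ⟨j, k, rfl, rfl, hfirst.1 hx⟩
      · rintro ⟨j, k, rfl, rfl, hj⟩
        exact hfirst.2 hj
    | last x z =>
      refine ⟨fun hx => ?_, ?_⟩
      · obtain ⟨j, k, rfl, rfl, -⟩ := hasg_form (hreason hx)
        exact ⟨j, k, rfl, rfl, hlast.1 hx⟩
      · rintro ⟨j, k, rfl, rfl, hj⟩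
        exact hlast.2 hj
    | next x y z =>
      refine ⟨fun hx => ?_, ?_⟩
      · obtain ⟨i, j, k, rfl, rfl, rfl, -⟩ := hbefore_form (hreason hx)
        exact ⟨i, j, k, rfl, rfl, rfl, hnext.1 hx⟩
      · rintro ⟨i, j, k, rfl, rfl, rfl, hb⟩
        exact hnext.2 hb
    | span z u =>
      refine ⟨fun hx => ?_, ?_⟩
      · obtain ⟨k, rfl⟩ := machine_mem_factAtoms.1
          (hreason (hreason hx).1 : .machine z ∈ factAtoms I h)
        exact ⟨k, rfl, (hs.span _ (hreason hx).1).unique ⟨(hreason hx).2, hx⟩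
          ⟨(hreason (hspan k)).2, hspan k⟩⟩
      · rintro ⟨k, rfl, rfl⟩
        exact hspan k
    | diff u v d => exact (ha trivial).elim
    | _ => exact ⟨fun hx => hreason hx, fun hx => hs.facts hx⟩
  · cases a <;> first | exact ha.elim | exact ⟨fun hx => hreason hx, fun hx => hs.diffs hx⟩

end Sched

/-! ### Optimality -/

namespace Sched

open ASP

variable {J M : Type*}

theorem Schedule.le_iff {I : ProblemInstance J M} (S : Schedule I) {k : M} {i j : J} :
    S.le k i j ↔ S.assign i = k ∧ i = j ∨ S.lt k i j := by
  constructor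
  · intro hle
    by_cases hij : i = j
    · exact .inl ⟨(S.le_assigned _ _ _ hle).1, hij⟩
    · exact .inr ⟨hle, hij⟩
  · rintro (⟨hi, rfl⟩ | hlt)
    exacts [S.le_refl _ _ hi, hlt.1]

theorem schedule_eq_of_answer_eq {I : ProblemInstance J M} {h : ℕ} {S S' : Schedule I}
    {t t' : M → ℕ} (heq : answer h S t = answer h S' t') : S = S' := by
  have hassign : S.assign = S'.assign := by
    funext j
    have : .asg (.job j) (.mach (S.assign j)) ∈ answer h S' t' :=
      heq ▸ asg_mem_answer.2 ⟨j, _, rfl, rfl, rfl⟩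
    obtain ⟨j', k, h1, h2, h3⟩ := asg_mem_answer.1 this
    obtain rfl := Const.job.inj h1
    exact (Const.mach.inj h2).trans h3.symm
  have hlt : ∀ k i j, S.lt k i j ↔ S'.lt k i j := by
    have (S : Schedule I) (t : M → ℕ) (k : M) (i j : J) :
        .before (.job i) (.job j) (.mach k) ∈ answer h S t ↔ S.lt k i j := by
      simp [before_mem_answer]
    intro k i j
    rw [← this S t, heq, this]
  refine Schedule.ext hassign ?_
  funext k i j
  rw [eq_iff_iff, S.le_iff, S'.le_iff, hassign, hlt]

variable [LinearOrder (Const J M)] [Fintype J] {I : ProblemInstance J M} {h : ℕ}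

/-- The answer sets with satisfiable difference constraints are given by a schedule together with
bounds for the machine spans, which are at most `h` and need not be tight. -/
theorem isDLAnswerSet_iff {X : Set (Atom J M)} [Fintype M] :
    IsDLAnswerSet (program I h) X ↔
      ∃ (S : Schedule I) (t : M → ℕ), (∀ k, S.span k ≤ t k) ∧ (∀ k, t k ≤ h) ∧
        X = answer h S t := by
  constructor
  · rintro ⟨hX, ν, hν⟩
    obtain ⟨S, t, ht, rfl⟩ := exists_eq_answer hX hν
    exact ⟨S, t, span_le_of_solves hν, ht, rfl⟩
  · rintro ⟨S, t, hst, ht, rfl⟩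
    exact ⟨isAnswerSet_answer ht, _, solves_values hst⟩

variable [Fintype M]

omit [LinearOrder (Const J M)] [Fintype J] in
theorem better_answer_iff {S S' : Schedule I} {t t' : M → ℕ} :
    Better objective (answer h S t) (answer h S' t') ↔
      CountLT (Finset.univ.val.map t) (Finset.univ.val.map t') :=
  better_objective_iff (fun _ _ => span_mem_answer) (fun _ _ => span_mem_answer)

/-- In an optimal answer set the span bounds are tight, and the schedule is optimal. -/
theorem isOptimalAnswerSet_iff
    (h_range : ∀ S : Schedule I, S.IsOptimal → ∀ k : M, S.span k ≤ h) {X : Set (Atom J M)} :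
    IsOptimalAnswerSet (program I h) objective X ↔
      ∃ S : Schedule I, S.IsOptimal ∧ X = answer h S S.span := by
  constructor
  · rintro ⟨hX, hopt⟩
    obtain ⟨S, t, hst, ht, rfl⟩ := isDLAnswerSet_iff.1 hX
    have htight : S.span = t := by
      by_contra hne
      exact hopt _ (isDLAnswerSet_iff.2 ⟨S, S.span, fun _ => le_rfl,
        fun k => (hst k).trans (ht k), rfl⟩) (better_answer_iff.2 (countLT_of_le hst hne))
    subst htight
    refine ⟨S, ?_, rfl⟩
    by_contra hS
    obtain ⟨S', hS', hlt⟩ := Schedule.exists_isOptimal_countLT hS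
    exact hopt _ (isDLAnswerSet_iff.2 ⟨S', S'.span, fun _ => le_rfl, h_range S' hS', rfl⟩)
      (better_answer_iff.2 hlt)
  · rintro ⟨S, hS, rfl⟩
    refine ⟨isDLAnswerSet_iff.2 ⟨S, S.span, fun _ => le_rfl, h_range S hS, rfl⟩, fun Y hY hlt => ?_⟩
    obtain ⟨S', t, hst, -, rfl⟩ := isDLAnswerSet_iff.1 hY
    have hlt := better_answer_iff.1 hlt
    refine hS S' (Schedule.lex_lexMakespan_iff.2 ?_)
    by_cases heq : S'.span = t
    · exact heq ▸ hlt
    · exact (countLT_of_le hst heq).trans hlt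

end Sched

theorem proposition2 {J M : Type*} [Fintype J] [Fintype M] [LinearOrder (Sched.Const J M)]
    (I : Sched.ProblemInstance J M) (h : ℕ)
    (h_range : ∀ S : Sched.Schedule I, S.IsOptimal → ∀ k : M, S.span k ≤ h) :
    ∃ e : {S : Sched.Schedule I // S.IsOptimal} ≃
        {X : Set (Sched.Atom J M) //
          Sched.IsOptimalAnswerSet (Sched.program I h) Sched.objective X},
      ∀ S, Sched.Encodes S.1 (e S).1 := by
  refine ⟨Equiv.ofBijective (fun S => ⟨Sched.answer h S.1 S.1.span,
    (Sched.isOptimalAnswerSet_iff h_range).2 ⟨S.1, S.2, rfl⟩⟩) ⟨fun S S' heq => ?_, ?_⟩,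
    fun S => Sched.encodes_answer⟩
  · exact Subtype.ext (Sched.schedule_eq_of_answer_eq (Subtype.mk.inj heq))
  · rintro ⟨X, hX⟩
    obtain ⟨S, hS, rfl⟩ := (Sched.isOptimalAnswerSet_iff h_range).1 hX
    exact ⟨⟨S, hS⟩, rfl⟩
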